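/- **Setting.** A set of $n$ pages is partitioned into blocks $B\in\mathcal B$ with at most $\beta$ pages each and costs $c_B>0$; the cache holds $k$ pages and $1\le\beta\le k$. At each time $t=1,\dots,T$ a page $p_t$ is requested and must then be in the cache. Fetching is free; evicting a nonempty set of pages of block $B$ in one time step costs $c_B$. Let $r(p,\tau)$ be the time of the last request to $p$ up to and including time $\tau$ ($-\infty$ if there is none). A flush is a pair $(B,t)\in\mathcal B\times\{0,\dots,T\}$. A page $p\in B$ is *missing* at time $\tau$ according to a set $S$ of flushes if $(B,t)\in S$ for some $t$ with $r(p,\tau)<t\le\tau$. Let $$f_\tau(S)=\min\bigl(n-k,\ |\{p : p\text{ is missing at time }\tau\text{ according to }S\}|\bigr),\qquad f_\tau(v\mid S)=f_\tau(S\cup\{v\})-f_\tau(S).$$ A fractional solution is a vector $\phi\ge 0$ with, for all $\tau\in\{1,\dots,T\}$ and all sets $S$ of flushes, $$\sum_{B,t} f_\tau((B,t)\mid S)\,\phi_B^t\ \ge\ n-k-f_\tau(S);\qquad\text{its cost is}\quad \sum_{B}\sum_{t\ge 1}c_B\,\phi_B^t .$$ The flush $(B,t)$ is *alive* at time $\tau$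 if $t=r(p,\tau)+1$ for some $p\in B$. For $t\le\tau$ let $\Phi_B^{t}(\tau)=\sum_u\phi_B^u$, the sum over all $u\le\tau$ such that $(B,u)$ makes the same pages of $B$ missing at time $\tau$ as $(B,t)$. **Theorem.** There is an absolute constant $K>0$ such that for every instance (pages, blocks, costs, $k$, $\beta$) there is an algorithm which receives the requests one by one and, after each finite request sequence, holds a fractional solution for that sequence, determined by the requests so far, such that: 1. (monotone-incremental) when a further request arrives, no variable $\phi_B^t$ (past or present) decreases; 2. at each time $\tau$ only variables $\phi_B^t$ of flushes alive at time $\tau$ are raised; 3. (continuous primal-dual scheme) initially $\phi_B^0=1$ for all $B$ and all other variables are $0$; at each time $\tau$ the solution is updated by finitely many continuous increases. In each of them a dual variable $y=y_{S'}^\tau$ is increased, for a set $S'$ such that throughout the increase, before its end, the constraint of $(S',\tau)$ is violated and $S'$ contains every flush $(B,t)$, $t\le\tau$, with $\Phi_B^t(\tau)\ge1$; meanwhile every alive $(B,t)$ grows at the rate $$\frac{d\phi_B^t}{dy}=\frac{\ln(k\beta+1)}{c_B}\, f_\tau((B,t)\mid S')\,\Bigl(\Phi_B^t(\tau)+\frac1{k\beta}\Bigr)$$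 and all other variables are unchanged; 4. ($O(\log k)$-competitive) for every request sequence, its cost is at most $K\ln(k+1)$ times the eviction cost of every offline cache policy (with at most $k$ pages in the cache at all times and arbitrary initial content), and also at most $K\ln(k+1)$ times the cost of every offline fractional solution. -/

import Mathlib

open Finset

/-- An instance of block-aware caching (without the request sequence): the pages `P` are
partitioned into blocks by `blk : P → Blk`, each block has at most `β` pages, `1 ≤ β ≤ k`,
`k` is the cache size, and `c B > 0` is the cost of block `B`. -/
structure BlockCaching (P Blk : Type*) [Fintype P] [DecidableEq Blk] where
  k : ℕ
  β : ℕ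
  one_le_β : 1 ≤ β
  β_le_k : β ≤ k
  blk : P → Blk
  block_card : ∀ B : Blk, #{p : P | blk p = B} ≤ β
  c : Blk → ℝ
  c_pos : ∀ B, 0 < c B

namespace BlockCaching

section

variable {P Blk : Type*} [Fintype P] [DecidableEq P] [Fintype Blk] [DecidableEq Blk]

/-! A request sequence is a list `σ`; its times are `1, …, T` with `T = σ.length`, and page `p` is
requested at time `s ≥ 1` iff `σ[s - 1]? = some p`.  A flush is a pair `(B, t) : Blk × ℕ`. -/

/-- `r(p, t)`: the time of the last request to `p` up until and including time `t`;
it is `⊥` (that is, `-∞`) if there is none. -/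
def lastReq (σ : List P) (p : P) (t : ℕ) : WithBot ℕ :=
  ((Finset.Icc 1 t).filter (fun s => σ[s - 1]? = some p)).max

/-- The set `Blk × [T]₀` of all flushes. -/
def flushes (Blk : Type*) [Fintype Blk] (σ : List P) : Finset (Blk × ℕ) :=
  (Finset.univ : Finset Blk) ×ˢ Finset.range (σ.length + 1)

variable (I : BlockCaching P Blk)

/-- Page `p` is missing at time `τ` according to the set `S` of flushes. -/
def Missing (σ : List P) (τ : ℕ) (S : Finset (Blk × ℕ)) (p : P) : Prop :=
  ∃ t : ℕ, lastReq σ p τ < (t : WithBot ℕ) ∧ t ≤ τ ∧ (I.blk p, t) ∈ S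

/-- The number `n - k`, as an integer. -/
def excess : ℤ := (Fintype.card P : ℤ) - (I.k : ℤ)

open Classical in
/-- The set function `f_τ(S) = min (n - k) #{p | p is missing at time τ according to S}`. -/
noncomputable def f (σ : List P) (τ : ℕ) (S : Finset (Blk × ℕ)) : ℤ :=
  min I.excess (#{p : P | I.Missing σ τ S p} : ℤ)

/-- The marginal value `f_τ(v ∣ S) = f_τ(S ∪ {v}) - f_τ(S)`. -/
noncomputable def marg (σ : List P) (τ : ℕ) (v : Blk × ℕ) (S : Finset (Blk × ℕ)) : ℤ :=
  I.f σ τ (insert v S) - I.f σ τ S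

/-- The constraint of the linear program that belongs to the pair `(S, τ)`. -/
def SatisfiesConstraint (σ : List P) (φ : Blk → ℕ → ℝ) (S : Finset (Blk × ℕ)) (τ : ℕ) : Prop :=
  ((I.excess - I.f σ τ S : ℤ) : ℝ) ≤
    ∑ v ∈ flushes Blk σ, (I.marg σ τ v S : ℝ) * φ v.1 v.2

/-- `φ` is a feasible solution of the linear program for the request sequence `σ`. -/
def Feasible (σ : List P) (φ : Blk → ℕ → ℝ) : Prop :=
  (∀ B, ∀ t ≤ σ.length, 0 ≤ φ B t) ∧
  ∀ τ ∈ Finset.Icc 1 σ.length, ∀ S ⊆ flushes Blk σ, I.SatisfiesConstraint σ φ S τ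

/-- The objective `∑_{B, t ≥ 1} c_B φ_B^t` of the linear program (flushes at time `0` are free). -/
noncomputable def fracCost (σ : List P) (φ : Blk → ℕ → ℝ) : ℝ :=
  ∑ B : Blk, ∑ t ∈ Finset.Icc 1 σ.length, I.c B * φ B t

/-- `C` is a feasible (integral) cache policy: `C t` is the content of the cache after the request
at time `t` has been served, and `C 0` is an arbitrary initial content. -/
def IsPolicy (σ : List P) (C : ℕ → Finset P) : Prop :=
  (∀ t ≤ σ.length, #(C t) ≤ I.k) ∧
  ∀ t ∈ Finset.Icc 1 σ.length, ∀ p : P, σ[t - 1]? = some p → p ∈ C t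

/-- The eviction cost of a cache policy: evicting a nonempty set of pages of block `B` in one time
step costs `c_B`. -/
noncomputable def evictionCost (σ : List P) (C : ℕ → Finset P) : ℝ :=
  ∑ t ∈ Finset.Icc 1 σ.length, ∑ B : Blk,
    if ∃ p ∈ C (t - 1) \ C t, I.blk p = B then I.c B else 0

/-- The flush `(B, t)` is alive at time `τ`: `t = r(p, τ) + 1` for some page `p` of `B`. -/
def Alive (σ : List P) (τ : ℕ) (B : Blk) (t : ℕ) : Prop :=
  ∃ p : P, I.blk p = B ∧ lastReq σ p τ + 1 = (t : WithBot ℕ)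

open Classical in
/-- The total value of the variables `φ_B^u`, `u ≤ τ`, such that the flush `(B, u)` makes the same
pages of `B` missing at time `τ` as the flush `(B, t)` does (this includes `u = t`). -/
noncomputable def mass (σ : List P) (τ : ℕ) (φ : Blk → ℕ → ℝ) (B : Blk) (t : ℕ) : ℝ :=
  ∑ u ∈ (Finset.range (τ + 1)).filter (fun u : ℕ => ∀ p : P, I.blk p = B →
    (lastReq σ p τ < (u : WithBot ℕ) ↔ lastReq σ p τ < (t : WithBot ℕ))), φ B u

/-- The initial solution: the characteristic vector of `{(B, 0) | B ∈ Blk}`. -/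
def initial (Blk : Type*) : Blk → ℕ → ℝ := fun _ t => if t = 0 then 1 else 0

/-- One continuous increase at time `τ = σ.length`, leading from `φ` to `φ'`.
The dual variable `y` of a constraint `(S', τ)` grows from `0` to `d`, and `γ y` is the primal
solution meanwhile.  All the time before the end the constraint is violated and `S'` contains every
flush that is already chosen to a total extent of at least `1`.  Alive flushes grow at rate
`dφ/dy = ln (kβ + 1) / c_B * f_τ((B, t) ∣ S') * (mass + 1 / (kβ))`; no other flush changes. -/
def Increase (σ : List P) (φ φ' : Blk → ℕ → ℝ) : Prop :=
  ∃ S' ⊆ flushes Blk σ, ∃ d : ℝ, 0 < d ∧ ∃ γ : ℝ → Blk → ℕ → ℝ,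
    γ 0 = φ ∧ γ d = φ' ∧
    (∀ y ∈ Set.Ico 0 d, ¬ I.SatisfiesConstraint σ (γ y) S' σ.length) ∧
    (∀ y ∈ Set.Ico 0 d, ∀ v ∈ flushes Blk σ, 1 ≤ I.mass σ σ.length (γ y) v.1 v.2 → v ∈ S') ∧
    ∀ y ∈ Set.Icc 0 d, ∀ B t,
      (I.Alive σ σ.length B t →
        HasDerivWithinAt (fun z => γ z B t)
          (Real.log (I.k * I.β + 1) / I.c B * (I.marg σ σ.length (B, t) S' : ℝ)
            * (I.mass σ σ.length (γ y) B t + 1 / (I.k * I.β)))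
          (Set.Icc 0 d) y) ∧
      (¬ I.Alive σ σ.length B t → γ y B t = φ B t)

/-- An online fractional algorithm: after every finite sequence `σ` of requests it holds a solution
`A σ` (which depends on these requests only) that is supported on `Blk × [σ.length]₀` and feasible
for the linear program of `σ`. -/
def IsFractionalAlgorithm (A : List P → Blk → ℕ → ℝ) : Prop :=
  ∀ σ, I.Feasible σ (A σ) ∧ ∀ B t, σ.length < t → A σ B t = 0

/-- When a further request arrives, no variable `φ_B^t`, past or present, decreases. -/
def IsMonotoneIncremental (A : List P → Blk → ℕ → ℝ) : Prop :=
  ∀ (σ : List P) (p : P) (B : Blk) (t : ℕ), A σ B t ≤ A (σ ++ [p]) B t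

/-- Only flushes that are alive at the current time are raised. -/
def RaisesOnlyAlive (A : List P → Blk → ℕ → ℝ) : Prop :=
  ∀ (σ : List P) (p : P) (B : Blk) (t : ℕ), A σ B t ≠ A (σ ++ [p]) B t →
    I.Alive (σ ++ [p]) (σ.length + 1) B t

/-- The algorithm starts with the flushes at time `0`, and it serves every request by finitely many
continuous increases. -/
def IsPrimalDualScheme (A : List P → Blk → ℕ → ℝ) : Prop :=
  A [] = initial Blk ∧
  ∀ (σ : List P) (p : P), Relation.ReflTransGen (I.Increase (σ ++ [p])) (A σ) (A (σ ++ [p]))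

/-- The cost of the algorithm is at most `ρ` times the eviction cost of every offline cache policy,
and also at most `ρ` times the cost of every offline fractional solution. -/
def IsCompetitive (A : List P → Blk → ℕ → ℝ) (ρ : ℝ) : Prop :=
  ∀ σ : List P,
    (∀ C : ℕ → Finset P, I.IsPolicy σ C → I.fracCost σ (A σ) ≤ ρ * I.evictionCost σ C) ∧
    (∀ ψ : Blk → ℕ → ℝ, I.Feasible σ ψ → I.fracCost σ (A σ) ≤ ρ * I.fracCost σ ψ)

end

end BlockCaching

set_option linter.unusedSectionVars false

/-! The proof is an online primal-dual argument. Write ε = 1/(kβ) and ℓ = ln(kβ+1). Two flushes of a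
block with the same effect are interchangeable in the current constraints, and such a class contains
at most one alive flush. So the prescribed differential equation closes up on masses: mass + ε grows
exponentially (`mass_flow`), which gives every increase in closed form (`flow`).

If some constraint is violated, adding all saturated flushes to its set keeps it violated
(`SatisfiesConstraint.of_union`). Its dual variable is raised until the constraint holds or another
flush saturates (`exists_stopping_time`). Both events are permanent and only finitely many are
possible, so each request is served after finitely many increases.

Primal cost grows at most 3ℓ times as fast as the dual value (`cost_rate_le`): violation bounds the
mass part of the rate by ℓ times the deficit n - k - f(S), and counting alive flushes bounds the ε
part by twice that amount (`sum_alive_marg_le`). The load of a flush grows like (c_B/ℓ) ln(mass +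
ε). Only unsaturated flushes gain load, so it never exceeds (c_B/ℓ) ln((1+ε)/ε) = c_B
(`load_flow_le`, `loadBound_le`). New requests only merge classes, so masses do not drop and the
bound survives (`mass_append_ge`). `Certified` is the resulting invariant.

Weak duality gives the ratio 3ℓ ≤ 6 ln(k+1), as β ≤ k. By submodularity of f, cache policies are
among the fractional competitors (`IsPolicy.feasible`). -/

theorem WithBot.eq_bot_or_eq_natCast (x : WithBot ℕ) : x = ⊥ ∨ ∃ r : ℕ, x = (r : WithBot ℕ) := by
  induction x using WithBot.recBotCoe with
  | bot => exact Or.inl rfl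
  | coe r => exact Or.inr ⟨r, rfl⟩

namespace BlockCaching

section

variable {P Blk : Type*} [Fintype P] [DecidableEq P] [Fintype Blk] [DecidableEq Blk]

/-! ### Last requests -/

theorem lastReq_le (σ : List P) (p : P) (t : ℕ) : lastReq σ p t ≤ (t : WithBot ℕ) := by
  refine Finset.max_le fun a ha => ?_
  simp only [mem_filter, mem_Icc] at ha
  exact Nat.cast_le.2 ha.1.2

theorem lastReq_append (σ : List P) (p q : P) {t : ℕ} (ht : t ≤ σ.length) :
    lastReq (σ ++ [p]) q t = lastReq σ q t := by
  unfold lastReq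
  congr 1
  refine filter_congr fun s hs => ?_
  rw [mem_Icc] at hs
  rw [List.getElem?_append_left (by omega)]

theorem lastReq_concat_ne (σ : List P) {p q : P} (h : p ≠ q) :
    lastReq (σ ++ [p]) q (σ.length + 1) = lastReq σ q σ.length := by
  rw [← lastReq_append σ p q le_rfl]
  unfold lastReq
  congr 1
  ext s
  simp only [mem_filter, mem_Icc]
  constructor
  · rintro ⟨⟨h1, h2⟩, h3⟩
    refine ⟨⟨h1, ?_⟩, h3⟩
    by_contra hs
    obtain rfl : s = σ.length + 1 := by omega
    simp at h3
    exact h h3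
  · rintro ⟨⟨h1, h2⟩, h3⟩
    exact ⟨⟨h1, by omega⟩, h3⟩

theorem lastReq_concat_self (σ : List P) (p : P) :
    lastReq (σ ++ [p]) p (σ.length + 1) = ((σ.length + 1 : ℕ) : WithBot ℕ) := by
  refine le_antisymm (lastReq_le _ _ _) ?_
  refine Finset.le_max ?_
  simp

theorem lastReq_eq_coe {σ : List P} {p : P} {τ r : ℕ} (h : lastReq σ p τ = (r : WithBot ℕ)) :
    r ∈ Finset.Icc 1 τ ∧ σ[r - 1]? = some p := by
  exact mem_filter.1 (Finset.mem_of_max h)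

variable (I : BlockCaching P Blk)

/-! ### The set function `f` -/

open Classical in
/-- The set of pages that are missing at time `τ` according to `S`. -/
noncomputable def missingSet (σ : List P) (τ : ℕ) (S : Finset (Blk × ℕ)) : Finset P :=
  {p : P | I.Missing σ τ S p}

theorem mem_missingSet {σ : List P} {τ : ℕ} {S : Finset (Blk × ℕ)} {p : P} :
    p ∈ I.missingSet σ τ S ↔ I.Missing σ τ S p := by
  simp [missingSet]

theorem f_eq (σ : List P) (τ : ℕ) (S : Finset (Blk × ℕ)) :
    I.f σ τ S = min I.excess (#(I.missingSet σ τ S) : ℤ) := rfl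

theorem missingSet_mono (σ : List P) (τ : ℕ) {S S' : Finset (Blk × ℕ)} (h : S ⊆ S') :
    I.missingSet σ τ S ⊆ I.missingSet σ τ S' := by
  intro p
  simp only [mem_missingSet]
  rintro ⟨t, h1, h2, h3⟩
  exact ⟨t, h1, h2, h h3⟩

theorem missingSet_insert (σ : List P) (τ : ℕ) (v : Blk × ℕ) (S : Finset (Blk × ℕ)) :
    I.missingSet σ τ (insert v S) = I.missingSet σ τ S ∪ I.missingSet σ τ {v} := by
  ext p
  simp only [mem_union, mem_missingSet, Missing, mem_insert, mem_singleton]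
  constructor
  · rintro ⟨t, h1, h2, h3 | h3⟩
    · exact Or.inr ⟨t, h1, h2, h3⟩
    · exact Or.inl ⟨t, h1, h2, h3⟩
  · rintro (⟨t, h1, h2, h3⟩ | ⟨t, h1, h2, h3⟩)
    · exact ⟨t, h1, h2, Or.inr h3⟩
    · exact ⟨t, h1, h2, Or.inl h3⟩

theorem mem_missingSet_singleton {σ : List P} {τ : ℕ} {B : Blk} {t : ℕ} {p : P} :
    p ∈ I.missingSet σ τ {(B, t)} ↔
      I.blk p = B ∧ lastReq σ p τ < (t : WithBot ℕ) ∧ t ≤ τ := by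
  simp only [mem_missingSet, Missing, mem_singleton, Prod.mk.injEq]
  constructor
  · rintro ⟨u, h1, h2, h3, rfl⟩
    exact ⟨h3, h1, h2⟩
  · rintro ⟨h1, h2, h3⟩
    exact ⟨t, h2, h3, h1, rfl⟩

theorem f_mono (σ : List P) (τ : ℕ) {S S' : Finset (Blk × ℕ)} (h : S ⊆ S') :
    I.f σ τ S ≤ I.f σ τ S' := by
  have := card_le_card (I.missingSet_mono σ τ h)
  rw [f_eq, f_eq]
  omega

theorem f_le_excess (σ : List P) (τ : ℕ) (S : Finset (Blk × ℕ)) : I.f σ τ S ≤ I.excess :=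
  min_le_left _ _

theorem marg_nonneg (σ : List P) (τ : ℕ) (v : Blk × ℕ) (S : Finset (Blk × ℕ)) :
    0 ≤ I.marg σ τ v S :=
  sub_nonneg.2 (I.f_mono σ τ (subset_insert v S))

theorem marg_eq_zero_of_mem (σ : List P) (τ : ℕ) {v : Blk × ℕ} {S : Finset (Blk × ℕ)}
    (h : v ∈ S) : I.marg σ τ v S = 0 := by
  rw [marg, insert_eq_of_mem h, sub_self]

theorem marg_congr (σ : List P) (τ : ℕ) {v w : Blk × ℕ} (S : Finset (Blk × ℕ))
    (h : I.missingSet σ τ {v} = I.missingSet σ τ {w}) : I.marg σ τ v S = I.marg σ τ w S := by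
  simp only [marg, f_eq, missingSet_insert, h]

theorem marg_eq_zero_of_subset (σ : List P) (τ : ℕ) {v : Blk × ℕ} {S : Finset (Blk × ℕ)}
    (h : I.missingSet σ τ {v} ⊆ I.missingSet σ τ S) : I.marg σ τ v S = 0 := by
  simp only [marg, f_eq, missingSet_insert, union_eq_left.2 h, sub_self]

theorem marg_eq_zero_of_lt (σ : List P) {τ : ℕ} {B : Blk} {t : ℕ} (S : Finset (Blk × ℕ))
    (h : τ < t) : I.marg σ τ (B, t) S = 0 := by
  refine I.marg_eq_zero_of_subset σ τ fun p hp => ?_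
  rw [mem_missingSet_singleton] at hp
  omega

theorem marg_le_excess_sub (σ : List P) (τ : ℕ) (v : Blk × ℕ) (S : Finset (Blk × ℕ)) :
    I.marg σ τ v S ≤ I.excess - I.f σ τ S :=
  sub_le_sub_right (I.f_le_excess σ τ _) _

theorem marg_le_card (σ : List P) (τ : ℕ) (v : Blk × ℕ) (S : Finset (Blk × ℕ)) :
    I.marg σ τ v S ≤ #(I.missingSet σ τ {v}) := by
  have := card_union_le (I.missingSet σ τ S) (I.missingSet σ τ {v})
  simp only [marg, f_eq, missingSet_insert]
  omega

theorem marg_le_blockSize (σ : List P) (τ : ℕ) (v : Blk × ℕ) (S : Finset (Blk × ℕ)) :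
    I.marg σ τ v S ≤ I.β := by
  refine (I.marg_le_card σ τ v S).trans ?_
  refine Nat.cast_le.2 ((card_le_card fun p hp => ?_).trans (I.block_card v.1))
  have := (I.mem_missingSet_singleton (B := v.1) (t := v.2)).1 hp
  simpa using this.1

/-- Submodularity: `f` is a coverage function truncated at a constant, and truncation preserves
submodularity of monotone functions. -/
theorem marg_anti (σ : List P) (τ : ℕ) (v : Blk × ℕ) {S S' : Finset (Blk × ℕ)} (h : S ⊆ S') :
    I.marg σ τ v S' ≤ I.marg σ τ v S := by
  have h1 := I.missingSet_mono σ τ h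
  have h2 := card_le_card h1
  have h3 : #(I.missingSet σ τ {v} \ I.missingSet σ τ S') ≤
      #(I.missingSet σ τ {v} \ I.missingSet σ τ S) :=
    card_le_card (sdiff_subset_sdiff le_rfl h1)
  have h4 := card_sdiff_add_card (I.missingSet σ τ {v}) (I.missingSet σ τ S)
  have h5 := card_sdiff_add_card (I.missingSet σ τ {v}) (I.missingSet σ τ S')
  simp only [marg, f_eq, missingSet_insert]
  rw [union_comm] at h4 h5
  omega

theorem f_union_sub_le_sum_marg (σ : List P) (τ : ℕ) (S U : Finset (Blk × ℕ)) :
    I.f σ τ (U ∪ S) - I.f σ τ S ≤ ∑ v ∈ U, I.marg σ τ v S := by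
  induction U using Finset.induction_on with
  | empty => simp
  | insert v U hv ih =>
    rw [sum_insert hv, insert_union]
    have := I.marg_anti σ τ v (subset_union_right : S ⊆ U ∪ S)
    rw [marg] at this
    linarith

theorem f_append (σ : List P) (p : P) {τ : ℕ} (hτ : τ ≤ σ.length) (S : Finset (Blk × ℕ)) :
    I.f (σ ++ [p]) τ S = I.f σ τ S := by
  have : I.missingSet (σ ++ [p]) τ S = I.missingSet σ τ S := by
    ext q
    simp only [mem_missingSet, Missing, lastReq_append σ p q hτ]
  rw [f_eq, f_eq, this]

theorem marg_append (σ : List P) (p : P) {τ : ℕ} (hτ : τ ≤ σ.length) (v : Blk × ℕ)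
    (S : Finset (Blk × ℕ)) : I.marg (σ ++ [p]) τ v S = I.marg σ τ v S := by
  rw [marg, marg, I.f_append σ p hτ, I.f_append σ p hτ]

/-- A flush of every block at the current time leaves only the requested page not missing, and k ≥
1. Hence a violated constraint always has some flush with positive marginal value. -/
theorem f_flushes (σ : List P) (p : P) :
    I.f (σ ++ [p]) (σ.length + 1) (flushes Blk (σ ++ [p])) = I.excess := by
  have h : (univ : Finset P).erase p ⊆
      I.missingSet (σ ++ [p]) (σ.length + 1) (flushes Blk (σ ++ [p])) := by
    intro q hq
    rw [mem_missingSet]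
    refine ⟨σ.length + 1, ?_, le_rfl, by simp [flushes]⟩
    rw [lastReq_concat_ne σ (ne_of_mem_erase hq).symm]
    refine (lastReq_le σ q σ.length).trans_lt ?_
    exact_mod_cast Nat.lt_succ_self _
  have h1 := card_le_card h
  rw [card_erase_of_mem (mem_univ p), card_univ] at h1
  have h2 := I.one_le_β
  have h3 := I.β_le_k
  rw [f_eq, excess]
  omega

/-! ### Constraints -/

theorem mem_flushes {σ : List P} {v : Blk × ℕ} : v ∈ flushes Blk σ ↔ v.2 ≤ σ.length := by
  simp [flushes]

theorem sum_flushes_append (σ : List P) (p : P) (g : Blk × ℕ → ℝ)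
    (hg : ∀ B, g (B, σ.length + 1) = 0) :
    ∑ v ∈ flushes Blk (σ ++ [p]), g v = ∑ v ∈ flushes Blk σ, g v := by
  refine (sum_subset (fun v hv => ?_) fun v hv hv' => ?_).symm
  · rw [mem_flushes] at hv ⊢
    simp; omega
  · rw [mem_flushes] at hv hv'
    simp only [List.length_append, List.length_singleton] at hv
    obtain ⟨B, t⟩ := v
    obtain rfl : t = σ.length + 1 := by simp only at hv hv'; omega
    exact hg B

theorem satisfiesConstraint_append (σ : List P) (p : P) {τ : ℕ} (hτ : τ ≤ σ.length)
    (φ : Blk → ℕ → ℝ) (S : Finset (Blk × ℕ)) :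
    I.SatisfiesConstraint (σ ++ [p]) φ S τ ↔ I.SatisfiesConstraint σ φ S τ := by
  unfold SatisfiesConstraint
  rw [sum_flushes_append, I.f_append σ p hτ]
  · simp only [I.marg_append σ p hτ]
  · intro B
    rw [I.marg_eq_zero_of_lt _ _ (by omega)]
    simp

theorem SatisfiesConstraint.mono {I : BlockCaching P Blk} {σ : List P} {φ φ' : Blk → ℕ → ℝ}
    {S : Finset (Blk × ℕ)} {τ : ℕ} (h : I.SatisfiesConstraint σ φ S τ)
    (hφ : ∀ B t, φ B t ≤ φ' B t) : I.SatisfiesConstraint σ φ' S τ := by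
  refine le_trans h (sum_le_sum fun v _ => ?_)
  exact mul_le_mul_of_nonneg_left (hφ _ _) (by exact_mod_cast I.marg_nonneg σ τ v S)

/-- Whether a constraint holds depends on the set of missing pages only. -/
theorem satisfiesConstraint_congr (σ : List P) (τ : ℕ) (φ : Blk → ℕ → ℝ)
    {S S' : Finset (Blk × ℕ)} (h : I.missingSet σ τ S = I.missingSet σ τ S') :
    I.SatisfiesConstraint σ φ S τ ↔ I.SatisfiesConstraint σ φ S' τ := by
  simp only [SatisfiesConstraint, marg, f_eq, missingSet_insert, h]

theorem missingSet_inter_flushes (σ : List P) {τ : ℕ} (hτ : τ ≤ σ.length)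
    (S : Finset (Blk × ℕ)) :
    I.missingSet σ τ (S ∩ flushes Blk σ) = I.missingSet σ τ S := by
  refine (I.missingSet_mono σ τ inter_subset_left).antisymm fun p => ?_
  simp only [mem_missingSet]
  rintro ⟨t, h1, h2, h3⟩
  exact ⟨t, h1, h2, mem_inter.2 ⟨h3, mem_flushes.2 (h2.trans hτ)⟩⟩

theorem Feasible.of_append {I : BlockCaching P Blk} {σ : List P} {p : P} {ψ : Blk → ℕ → ℝ}
    (h : I.Feasible (σ ++ [p]) ψ) : I.Feasible σ ψ := by
  refine ⟨fun B t ht => h.1 B t (by simp; omega), fun τ hτ S hS => ?_⟩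
  rw [mem_Icc] at hτ
  rw [← I.satisfiesConstraint_append σ p hτ.2]
  refine h.2 τ (by simp; omega) S fun v hv => ?_
  have := mem_flushes.1 (hS hv)
  exact mem_flushes.2 (by simp; omega)

theorem Feasible.append {I : BlockCaching P Blk} {σ : List P} {p : P} {φ φ' : Blk → ℕ → ℝ}
    (h : I.Feasible σ φ) (hφ : ∀ B t, φ B t ≤ φ' B t) (h0 : ∀ B t, 0 ≤ φ' B t)
    (hsat : ∀ S ⊆ flushes Blk (σ ++ [p]),
      I.SatisfiesConstraint (σ ++ [p]) φ' S (σ.length + 1)) :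
    I.Feasible (σ ++ [p]) φ' := by
  refine ⟨fun B t _ => h0 B t, fun τ hτ S hS => ?_⟩
  simp only [mem_Icc, List.length_append, List.length_singleton] at hτ
  rcases hτ.2.lt_or_eq with hlt | rfl
  -- `S` may contain flushes at the new time; they have no effect at an earlier `τ`, so they can be
  -- dropped.
  · have hle : τ ≤ σ.length := by omega
    rw [I.satisfiesConstraint_append σ p hle,
      ← I.satisfiesConstraint_congr σ τ φ' (I.missingSet_inter_flushes σ hle S)]
    exact (h.2 τ (mem_Icc.2 ⟨hτ.1, hle⟩) _ inter_subset_right).mono hφ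
  · exact hsat S hS

/-! ### Flushes with the same effect -/

/-- The flushes `(B, u)` and `(B, t)` make the same pages of `B` missing at time `τ`. -/
def SameEffect (σ : List P) (τ : ℕ) (B : Blk) (u t : ℕ) : Prop :=
  ∀ p : P, I.blk p = B → (lastReq σ p τ < (u : WithBot ℕ) ↔ lastReq σ p τ < (t : WithBot ℕ))

variable {I}

theorem SameEffect.symm {σ : List P} {τ : ℕ} {B : Blk} {u t : ℕ} (h : I.SameEffect σ τ B u t) :
    I.SameEffect σ τ B t u := fun p hp => (h p hp).symm

theorem SameEffect.trans {σ : List P} {τ : ℕ} {B : Blk} {u t s : ℕ}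
    (h : I.SameEffect σ τ B u t) (h' : I.SameEffect σ τ B t s) : I.SameEffect σ τ B u s :=
  fun p hp => (h p hp).trans (h' p hp)

theorem SameEffect.marg_eq {σ : List P} {τ : ℕ} {B : Blk} {u t : ℕ}
    (h : I.SameEffect σ τ B u t) (hu : u ≤ τ) (ht : t ≤ τ) (S : Finset (Blk × ℕ)) :
    I.marg σ τ (B, u) S = I.marg σ τ (B, t) S := by
  refine I.marg_congr σ τ S ?_
  ext p
  simp only [mem_missingSet_singleton, hu, ht, and_true]
  exact and_congr_right (h p)

variable (I)

open Classical in
theorem mass_eq (σ : List P) (τ : ℕ) (φ : Blk → ℕ → ℝ) (B : Blk) (t : ℕ) :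
    I.mass σ τ φ B t = ∑ u ∈ range (τ + 1) with I.SameEffect σ τ B u t, φ B u := by
  unfold mass SameEffect
  congr!

variable {I}

theorem SameEffect.mass_eq {σ : List P} {τ : ℕ} {B : Blk} {u t : ℕ}
    (h : I.SameEffect σ τ B u t) (φ : Blk → ℕ → ℝ) :
    I.mass σ τ φ B u = I.mass σ τ φ B t := by
  classical
  rw [I.mass_eq, I.mass_eq]
  refine sum_congr (filter_congr fun s _ => ⟨fun hs => hs.trans h, fun hs => hs.trans h.symm⟩)
    fun _ _ => rfl

/-- Neither flush makes the newly requested page missing any more, and nothing changes for other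
pages: classes can merge but never split. -/
theorem SameEffect.append {σ : List P} {B : Blk} {u t : ℕ}
    (h : I.SameEffect σ σ.length B u t) (p : P) (hu : u ≤ σ.length) (ht : t ≤ σ.length) :
    I.SameEffect (σ ++ [p]) (σ.length + 1) B u t := by
  intro q hq
  by_cases hpq : p = q
  · subst hpq
    rw [lastReq_concat_self]
    simp only [Nat.cast_lt]
    omega
  · rw [lastReq_concat_ne σ hpq]
    exact h q hq

/-- An alive flush is the earliest of its class: any earlier one fails to make missing the page
whose last request it follows. -/
theorem Alive.eq_of_sameEffect {σ : List P} {τ : ℕ} {B : Blk} {u t : ℕ}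
    (hu : I.Alive σ τ B u) (ht : I.Alive σ τ B t) (h : I.SameEffect σ τ B u t) : u = t := by
  have key : ∀ {u t : ℕ}, I.Alive σ τ B u → I.SameEffect σ τ B u t → u ≤ t := by
    rintro u t ⟨p, hp, hpu⟩ h
    have h1 := h p hp
    generalize lastReq σ p τ = r at *
    rcases WithBot.eq_bot_or_eq_natCast r with rfl | ⟨r, rfl⟩
    · simp at hpu
    · have : r + 1 = u := by exact_mod_cast hpu
      subst this
      have h2 : (r : WithBot ℕ) < ((r + 1 : ℕ) : WithBot ℕ) := by
        exact_mod_cast Nat.lt_succ_self r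
      have h3 : r < t := by exact_mod_cast h1.1 h2
      exact h3
  exact le_antisymm (key hu h) (key ht h.symm)

variable (I)

/-- The alive representative comes right after the latest last request among the pages of `B` that
the flush makes missing. Pages never requested yield no alive flush, since `⊥ + 1 = ⊥`; this is the
second alternative. -/
theorem exists_alive_sameEffect (σ : List P) (τ : ℕ) (B : Blk) (t : ℕ) :
    (∃ t' ≤ t, I.Alive σ τ B t' ∧ I.SameEffect σ τ B t' t) ∨
      ∀ p, I.blk p = B → lastReq σ p τ < (t : WithBot ℕ) → lastReq σ p τ = ⊥ := by
  classical
  by_cases h : ∃ p, I.blk p = B ∧ lastReq σ p τ < (t : WithBot ℕ) ∧ lastReq σ p τ ≠ ⊥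
  · left
    obtain ⟨p₀, hp₀⟩ := h
    obtain ⟨p, hp, hmax⟩ := exists_max_image
      ({p : P | I.blk p = B ∧ lastReq σ p τ < (t : WithBot ℕ) ∧ lastReq σ p τ ≠ ⊥} : Finset P)
      (fun p => lastReq σ p τ) ⟨p₀, by simpa using hp₀⟩
    simp only [mem_filter, mem_univ, true_and] at hp hmax
    obtain ⟨hpB, hpt, hpne⟩ := hp
    obtain ⟨r, hr⟩ := WithBot.ne_bot_iff_exists.1 hpne
    rw [← hr] at hpt
    have hrt : r < t := WithBot.coe_lt_coe.1 hpt
    refine ⟨r + 1, hrt, ⟨p, hpB, by rw [← hr]; rfl⟩, fun q hq => ⟨fun h => ?_, fun h => ?_⟩⟩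
    · exact h.trans_le (by exact_mod_cast hrt)
    · by_cases hq' : lastReq σ q τ = ⊥
      · rw [hq']; exact WithBot.bot_lt_coe _
      · refine (hmax q ⟨hq, h, hq'⟩).trans_lt ?_
        rw [← hr]
        exact WithBot.coe_lt_coe.2 (Nat.lt_succ_self r)
  · right
    intro p hp hpt
    by_contra hne
    exact h ⟨p, hp, hpt, hne⟩

/-- In the exceptional case only pages never requested are affected, and `(B, 0)` already makes
these missing. -/
theorem exists_alive_of_marg_ne_zero {σ : List P} {τ : ℕ} {B : Blk} {t : ℕ}
    {S : Finset (Blk × ℕ)} (hS : (B, 0) ∈ S) (h : I.marg σ τ (B, t) S ≠ 0) :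
    ∃ t' ≤ t, I.Alive σ τ B t' ∧ I.SameEffect σ τ B t' t := by
  refine (I.exists_alive_sameEffect σ τ B t).resolve_right fun h' => h ?_
  refine I.marg_eq_zero_of_subset σ τ fun p hp => ?_
  rw [mem_missingSet_singleton] at hp
  rw [mem_missingSet]
  refine ⟨0, ?_, Nat.zero_le _, by rwa [hp.1]⟩
  rw [h' p hp.1 hp.2.1]
  exact WithBot.bot_lt_coe _

open Classical in
/-- A class of flushes with the same effect contains at most one alive flush. -/
theorem sum_alive_sameEffect (σ : List P) (τ : ℕ) (B : Blk) {u : ℕ} (hu : u ≤ τ) (G : ℕ → ℝ)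
    (hG : ∀ t ≤ τ, I.SameEffect σ τ B t u → G t = G u)
    (hG0 : (¬ ∃ t ≤ u, I.Alive σ τ B t ∧ I.SameEffect σ τ B t u) → G u = 0) :
    ∑ t ∈ range (τ + 1) with I.SameEffect σ τ B t u, (if I.Alive σ τ B t then G t else 0)
      = G u := by
  by_cases h : ∃ t ≤ u, I.Alive σ τ B t ∧ I.SameEffect σ τ B t u
  · obtain ⟨t, htu, hta, hts⟩ := h
    rw [sum_eq_single t]
    · rw [if_pos hta, hG t (htu.trans hu) hts]
    · intro s hs hst
      rw [if_neg]
      intro hsa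
      rw [mem_filter] at hs
      exact hst (hsa.eq_of_sameEffect hta (hs.2.trans hts.symm))
    · intro hn
      exact (hn (mem_filter.2 ⟨mem_range.2 (by omega), hts⟩)).elim
  · rw [hG0 h]
    refine sum_eq_zero fun t ht => if_neg fun hta => ?_
    rw [mem_filter, mem_range] at ht
    rcases I.exists_alive_sameEffect σ τ B u with h1 | h1
    · exact h h1
    · obtain ⟨p, hp, hpt⟩ := hta
      have h2 := h1 p hp
      have h3 := ht.2 p hp
      generalize lastReq σ p τ = r at *
      rcases WithBot.eq_bot_or_eq_natCast r with rfl | ⟨r, rfl⟩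
      · simp at hpt
      · have h4 : r + 1 = t := by exact_mod_cast hpt
        subst h4
        exact WithBot.coe_ne_bot (h2 (h3.1 (WithBot.coe_lt_coe.2 (Nat.lt_succ_self r))))

open Classical in
-- Expand the mass and exchange the sums: each flush is counted once, through the alive member of
-- its class. Classes without one have marginal value zero.
theorem sum_marg_mul_mass (σ : List P) (φ : Blk → ℕ → ℝ) {S : Finset (Blk × ℕ)}
    (hS : ∀ B, (B, 0) ∈ S) :
    ∑ v ∈ flushes Blk σ, (if I.Alive σ σ.length v.1 v.2 then
        (I.marg σ σ.length v S : ℝ) * I.mass σ σ.length φ v.1 v.2 else 0)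
      = ∑ v ∈ flushes Blk σ, (I.marg σ σ.length v S : ℝ) * φ v.1 v.2 := by
  rw [flushes, sum_product, sum_product]
  refine sum_congr rfl fun B _ => ?_
  simp only
  have h1 : ∀ t ∈ range (σ.length + 1), (if I.Alive σ σ.length B t then
        (I.marg σ σ.length (B, t) S : ℝ) * I.mass σ σ.length φ B t else 0)
      = ∑ u ∈ range (σ.length + 1), if I.SameEffect σ σ.length B t u then
        (if I.Alive σ σ.length B t then (I.marg σ σ.length (B, t) S : ℝ) * φ B u else 0)
          else 0 := by
    intro t _
    split_ifs with h
    · rw [mass_eq, sum_filter, mul_sum]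
      refine sum_congr rfl fun u _ => ?_
      have : I.SameEffect σ σ.length B u t ↔ I.SameEffect σ σ.length B t u :=
        ⟨SameEffect.symm, SameEffect.symm⟩
      simp only [this, mul_ite, mul_zero]
    · simp
  rw [sum_congr rfl h1, sum_comm]
  refine sum_congr rfl fun u hu => ?_
  rw [mem_range, Nat.lt_succ_iff] at hu
  rw [← sum_filter]
  refine I.sum_alive_sameEffect σ σ.length B hu
    (fun t => (I.marg σ σ.length (B, t) S : ℝ) * φ B u) (fun t ht h => ?_) fun h => ?_
  · simp only [h.marg_eq ht hu]
  · have : I.marg σ σ.length (B, u) S = 0 := by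
      by_contra hne
      exact h (I.exists_alive_of_marg_ne_zero (hS B) hne)
    simp [this]

open Classical in
theorem card_alive_marg_ne_zero (σ : List P) (S : Finset (Blk × ℕ)) :
    #{v ∈ flushes Blk σ | I.Alive σ σ.length v.1 v.2 ∧ I.marg σ σ.length v S ≠ 0} ≤
      #(I.missingSet σ σ.length S)ᶜ := by
  -- An alive flush follows the last request of some page `p`. If `p` were already missing, so would
  -- be every page the flush affects, and the marginal value would vanish. The default `0` for `⊥`
  -- is never relevant.
  refine (card_le_card (t := ((I.missingSet σ σ.length S)ᶜ).image
    (fun p => (I.blk p, (lastReq σ p σ.length).unbotD 0 + 1))) ?_).trans card_image_le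
  rintro ⟨B, t⟩ hv
  simp only [mem_filter] at hv
  obtain ⟨-, ⟨p, hpB, hpt⟩, hne⟩ := hv
  refine mem_image.2 ⟨p, ?_, ?_⟩
  · rw [mem_compl, mem_missingSet]
    rintro ⟨u, hu, huT, huS⟩
    refine hne (I.marg_eq_zero_of_subset _ _ fun q hq => ?_)
    rw [mem_missingSet_singleton] at hq
    rw [mem_missingSet]
    refine ⟨u, ?_, huT, by rwa [hq.1, ← hpB]⟩
    refine lt_of_le_of_lt ?_ hu
    have h2 := hq.2.1
    rw [← hpt] at h2
    generalize lastReq σ p σ.length = r at *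
    generalize lastReq σ q σ.length = s at *
    rcases WithBot.eq_bot_or_eq_natCast r with rfl | ⟨r, rfl⟩
    · simp at h2
    · rcases WithBot.eq_bot_or_eq_natCast s with rfl | ⟨s, rfl⟩
      · exact bot_le
      · have : s < r + 1 := by exact_mod_cast h2
        exact Nat.cast_le.2 (by omega)
  · generalize lastReq σ p σ.length = r at *
    rcases WithBot.eq_bot_or_eq_natCast r with rfl | ⟨r, rfl⟩
    · simp at hpt
    · have : r + 1 = t := by exact_mod_cast hpt
      simpa [hpB] using this

open Classical in
-- With q pages not missing, the deficit is q - k, and at most q alive flushes count, each with at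
-- most min(q - k, β). If q ≤ 2k, use the bound q - k; otherwise q ≤ 2(q - k), and β is the right
-- bound.
theorem sum_alive_marg_le (σ : List P) {S : Finset (Blk × ℕ)}
    (hS : I.f σ σ.length S < I.excess) :
    ∑ v ∈ flushes Blk σ, (if I.Alive σ σ.length v.1 v.2 then I.marg σ σ.length v S else 0)
      ≤ 2 * (I.k * I.β) * (I.excess - I.f σ σ.length S) := by
  set q := #(I.missingSet σ σ.length S)ᶜ with hq
  have hqf : I.excess - I.f σ σ.length S = q - I.k := by
    have h1 := card_compl (I.missingSet σ σ.length S)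
    have h2 := card_le_univ (I.missingSet σ σ.length S)
    rw [f_eq] at hS ⊢
    rw [excess] at hS ⊢
    omega
  set m : ℤ := min (q - I.k) I.β with hm
  have hm0 : 0 ≤ m := le_min (by omega) (by omega)
  have h1 : ∑ v ∈ flushes Blk σ,
      (if I.Alive σ σ.length v.1 v.2 then I.marg σ σ.length v S else 0) ≤ q * m := by
    have h2 : ∑ v ∈ flushes Blk σ,
        (if I.Alive σ σ.length v.1 v.2 then I.marg σ σ.length v S else 0)
        = ∑ v ∈ flushes Blk σ with I.Alive σ σ.length v.1 v.2 ∧ I.marg σ σ.length v S ≠ 0,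
          I.marg σ σ.length v S := by
      rw [sum_filter]
      refine sum_congr rfl fun v _ => ?_
      by_cases h : I.marg σ σ.length v S = 0 <;> simp [h]
    rw [h2]
    refine (sum_le_card_nsmul _ _ m fun v _ => ?_).trans ?_
    · exact le_min (hqf ▸ I.marg_le_excess_sub σ _ v S) (I.marg_le_blockSize σ _ v S)
    · rw [nsmul_eq_mul]
      exact mul_le_mul_of_nonneg_right
        (by exact_mod_cast I.card_alive_marg_ne_zero σ S) hm0
  rw [hqf]
  refine h1.trans ?_
  have hk : (1 : ℤ) ≤ I.k := by have := I.one_le_β; have := I.β_le_k; omega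
  have hβ : (1 : ℤ) ≤ I.β := by exact_mod_cast I.one_le_β
  have hqk : (0 : ℤ) < q - I.k := by omega
  rcases le_total (q : ℤ) (2 * I.k) with h | h
  · have h3 : m ≤ q - I.k := min_le_left _ _
    calc (q : ℤ) * m ≤ (2 * I.k) * (q - I.k) :=
          mul_le_mul h h3 hm0 (by omega)
      _ = 2 * (I.k * 1) * (q - I.k) := by ring
      _ ≤ _ := by gcongr
  · have h3 : m ≤ I.β := min_le_right _ _
    calc (q : ℤ) * m ≤ (2 * (q - I.k)) * I.β :=
          mul_le_mul (by omega) h3 hm0 (by omega)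
      _ = 2 * (1 * I.β) * (q - I.k) := by ring
      _ ≤ _ := by gcongr

end

section

variable {P Blk : Type*} [Fintype P] [DecidableEq P] [Fintype Blk] [DecidableEq Blk]
variable (I : BlockCaching P Blk)

/-! ### Saturated flushes -/

theorem k_pos : (0 : ℝ) < I.k := by
  have := I.one_le_β; have := I.β_le_k
  exact_mod_cast (by omega : 0 < I.k)

theorem blockSize_pos : (0 : ℝ) < I.β := by
  exact_mod_cast I.one_le_β

theorem log_pos : 0 < Real.log (I.k * I.β + 1) :=
  Real.log_pos (by have := mul_pos I.k_pos I.blockSize_pos; linarith)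

theorem one_div_mul_pos : (0 : ℝ) < 1 / (I.k * I.β) :=
  one_div_pos.2 (mul_pos I.k_pos I.blockSize_pos)

theorem mass_mono (σ : List P) (τ : ℕ) {φ φ' : Blk → ℕ → ℝ} (h : ∀ B t, φ B t ≤ φ' B t)
    (B : Blk) (t : ℕ) : I.mass σ τ φ B t ≤ I.mass σ τ φ' B t :=
  sum_le_sum fun _ _ => h _ _

theorem mass_nonneg (σ : List P) (τ : ℕ) {φ : Blk → ℕ → ℝ} (h : ∀ B t, 0 ≤ φ B t)
    (B : Blk) (t : ℕ) : 0 ≤ I.mass σ τ φ B t :=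
  sum_nonneg fun _ _ => h _ _

theorem le_mass (σ : List P) {τ : ℕ} {φ : Blk → ℕ → ℝ} (h : ∀ B t, 0 ≤ φ B t)
    (B : Blk) {t : ℕ} (ht : t ≤ τ) : φ B t ≤ I.mass σ τ φ B t := by
  classical
  rw [mass_eq]
  exact single_le_sum (f := fun u => φ B u) (fun _ _ => h _ _)
    (mem_filter.2 ⟨mem_range.2 (by omega), fun _ _ => Iff.rfl⟩)

/-- Removing `w` from the set raises the requirement by the marginal value of `w`. The class of `w`
regains this marginal value times its mass, which is at least 1; all other terms only grow, by
submodularity. -/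
theorem SatisfiesConstraint.of_insert {I : BlockCaching P Blk} {σ : List P} {φ : Blk → ℕ → ℝ}
    (hφ : ∀ B t, 0 ≤ φ B t) {S : Finset (Blk × ℕ)} {w : Blk × ℕ} (hw : w ∈ flushes Blk σ)
    (hm : 1 ≤ I.mass σ σ.length φ w.1 w.2)
    (h : I.SatisfiesConstraint σ φ (insert w S) σ.length) :
    I.SatisfiesConstraint σ φ S σ.length := by
  classical
  obtain ⟨B, t⟩ := w
  rw [mem_flushes] at hw
  have hsum : ∑ v ∈ flushes Blk σ, (if v.1 = B ∧ I.SameEffect σ σ.length B v.2 t then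
      (I.marg σ σ.length (B, t) S : ℝ) * φ v.1 v.2 else 0)
      = (I.marg σ σ.length (B, t) S : ℝ) * I.mass σ σ.length φ B t := by
    rw [flushes, sum_product, sum_eq_single B, mass_eq, mul_sum, sum_filter]
    · simp
    · intro B' _ hB'
      exact sum_eq_zero fun u _ => if_neg fun h => hB' h.1
    · intro hB
      exact absurd (mem_univ B) hB
  have hle : ∑ v ∈ flushes Blk σ, ((I.marg σ σ.length v (insert (B, t) S) : ℝ) * φ v.1 v.2 +
      if v.1 = B ∧ I.SameEffect σ σ.length B v.2 t then
      (I.marg σ σ.length (B, t) S : ℝ) * φ v.1 v.2 else 0)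
      ≤ ∑ v ∈ flushes Blk σ, (I.marg σ σ.length v S : ℝ) * φ v.1 v.2 := by
    refine sum_le_sum fun v hv => ?_
    rw [mem_flushes] at hv
    obtain ⟨B', u⟩ := v
    split_ifs with hc
    · obtain ⟨rfl, hs⟩ := hc
      rw [hs.marg_eq hv hw, hs.marg_eq hv hw,
        I.marg_eq_zero_of_mem _ _ (mem_insert_self _ _)]
      simp
    · rw [add_zero]
      exact mul_le_mul_of_nonneg_right
        (by exact_mod_cast I.marg_anti σ _ _ (subset_insert _ S)) (hφ _ _)
  rw [sum_add_distrib, hsum] at hle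
  unfold SatisfiesConstraint at h ⊢
  have h1 : (I.marg σ σ.length (B, t) S : ℝ) ≤
      (I.marg σ σ.length (B, t) S : ℝ) * I.mass σ σ.length φ B t :=
    le_mul_of_one_le_right (by exact_mod_cast I.marg_nonneg σ _ _ S) hm
  have h2 : (I.marg σ σ.length (B, t) S : ℝ) =
      I.f σ σ.length (insert (B, t) S) - I.f σ σ.length S := by
    rw [marg]; push_cast; ring
  push_cast at h ⊢
  linarith

theorem SatisfiesConstraint.of_union {I : BlockCaching P Blk} {σ : List P} {φ : Blk → ℕ → ℝ}
    (hφ : ∀ B t, 0 ≤ φ B t) {S U : Finset (Blk × ℕ)}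
    (hU : ∀ w ∈ U, w ∈ flushes Blk σ ∧ 1 ≤ I.mass σ σ.length φ w.1 w.2)
    (h : I.SatisfiesConstraint σ φ (U ∪ S) σ.length) :
    I.SatisfiesConstraint σ φ S σ.length := by
  induction U using Finset.induction_on with
  | empty => simpa using h
  | insert w U hw ih =>
    rw [insert_union] at h
    have hw' := hU w (mem_insert_self w U)
    exact ih (fun v hv => hU v (mem_insert_of_mem hv)) (h.of_insert hφ hw'.1 hw'.2)

/-! ### The continuous increase in closed form -/

/-- The exponential growth rate of the mass of `(B, t)` while the dual variable of `S` is raised. -/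
noncomputable def rate (σ : List P) (S : Finset (Blk × ℕ)) (B : Blk) (t : ℕ) : ℝ :=
  Real.log (I.k * I.β + 1) / I.c B * (I.marg σ σ.length (B, t) S : ℝ)

theorem rate_nonneg (σ : List P) (S : Finset (Blk × ℕ)) (B : Blk) (t : ℕ) :
    0 ≤ I.rate σ S B t :=
  mul_nonneg (div_nonneg I.log_pos.le (I.c_pos B).le) (by exact_mod_cast I.marg_nonneg σ _ _ S)

open Classical in
/-- The primal solution after the dual variable of `S` has been raised by `y`, starting at `φ`. -/
noncomputable def flow (σ : List P) (φ : Blk → ℕ → ℝ) (S : Finset (Blk × ℕ)) (y : ℝ)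
    (B : Blk) (t : ℕ) : ℝ :=
  φ B t + if I.Alive σ σ.length B t then
    (I.mass σ σ.length φ B t + 1 / (I.k * I.β)) * (Real.exp (I.rate σ S B t * y) - 1) else 0

variable (σ : List P) (φ : Blk → ℕ → ℝ) (S : Finset (Blk × ℕ))

theorem flow_zero : I.flow σ φ S 0 = φ := by
  funext B t
  simp [flow]

theorem flow_of_not_alive (y : ℝ) {B : Blk} {t : ℕ} (h : ¬ I.Alive σ σ.length B t) :
    I.flow σ φ S y B t = φ B t := by
  simp [flow, h]

theorem flow_of_lt (y : ℝ) {B : Blk} {t : ℕ} (h : σ.length < t) :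
    I.flow σ φ S y B t = φ B t := by
  simp [flow, rate, I.marg_eq_zero_of_lt σ S h]

variable {φ} in
theorem le_flow (hφ : ∀ B t, 0 ≤ φ B t) {y : ℝ} (hy : 0 ≤ y) (B : Blk) (t : ℕ) :
    φ B t ≤ I.flow σ φ S y B t := by
  unfold flow
  split_ifs
  · refine le_add_of_nonneg_right (mul_nonneg ?_ ?_)
    · exact add_nonneg (I.mass_nonneg σ _ hφ B t) I.one_div_mul_pos.le
    · exact sub_nonneg.2 (Real.one_le_exp (mul_nonneg (I.rate_nonneg σ S B t) hy))
  · simp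

theorem continuous_flow (B : Blk) (t : ℕ) : Continuous fun y => I.flow σ φ S y B t := by
  unfold flow
  split_ifs <;> fun_prop

theorem continuous_mass_flow (B : Blk) (t : ℕ) :
    Continuous fun y => I.mass σ σ.length (I.flow σ φ S y) B t := by
  unfold mass
  exact continuous_finsetSum _ fun u _ => I.continuous_flow σ φ S B u

variable {S}

/-- The only moving member of a class is its alive flush, so the increment of the mass is the
increment of that variable. A class with no alive flush has rate zero because `(B, 0) ∈ S`. -/
theorem mass_flow (y : ℝ) {B : Blk} {t : ℕ} (hS : (B, 0) ∈ S) (ht : t ≤ σ.length) :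
    I.mass σ σ.length (I.flow σ φ S y) B t + 1 / (I.k * I.β) =
      (I.mass σ σ.length φ B t + 1 / (I.k * I.β)) * Real.exp (I.rate σ S B t * y) := by
  classical
  have h := I.sum_alive_sameEffect σ σ.length B ht
    (fun u => (I.mass σ σ.length φ B u + 1 / (I.k * I.β)) *
      (Real.exp (I.rate σ S B u * y) - 1))
    (fun u hu hs => by simp only [rate, hs.marg_eq hu ht, hs.mass_eq])
    (fun hn => by
      have : I.marg σ σ.length (B, t) S = 0 := by
        by_contra hne
        exact hn (I.exists_alive_of_marg_ne_zero hS hne)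
      simp [rate, this])
  have h2 : I.mass σ σ.length (I.flow σ φ S y) B t = I.mass σ σ.length φ B t +
      (I.mass σ σ.length φ B t + 1 / (I.k * I.β)) * (Real.exp (I.rate σ S B t * y) - 1) := by
    rw [← h, I.mass_eq σ σ.length (I.flow σ φ S y) B t]
    unfold flow
    rw [sum_add_distrib, ← I.mass_eq]
  rw [h2]
  ring

open Classical in
theorem hasDerivAt_flow (y : ℝ) {B : Blk} {t : ℕ} (hS : (B, 0) ∈ S) :
    HasDerivAt (fun z => I.flow σ φ S z B t)
      (if I.Alive σ σ.length B t then
        I.rate σ S B t * (I.mass σ σ.length (I.flow σ φ S y) B t + 1 / (I.k * I.β)) else 0) y := by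
  rcases le_or_gt t σ.length with ht | ht
  · split_ifs with h
    · have h1 : HasDerivAt (fun z => Real.exp (I.rate σ S B t * z))
          (Real.exp (I.rate σ S B t * y) * (I.rate σ S B t * 1)) y :=
        ((hasDerivAt_id y).const_mul (I.rate σ S B t)).exp
      have h2 := ((h1.sub_const 1).const_mul
        (I.mass σ σ.length φ B t + 1 / (I.k * I.β))).const_add (φ B t)
      simp only [flow, if_pos h]
      refine h2.congr_deriv ?_
      rw [I.mass_flow σ φ y hS ht]
      ring
    · simpa [flow, h] using hasDerivAt_const y (φ B t)
  -- The flush right after a page requested now is alive but lies in the future; its marginal value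
  -- is zero, so it stays put.
  · have h0 : I.rate σ S B t = 0 := by simp [rate, I.marg_eq_zero_of_lt σ S ht]
    have h1 : (fun z => I.flow σ φ S z B t) = fun _ => φ B t :=
      funext fun z => I.flow_of_lt σ φ S z ht
    rw [h0, h1]
    simpa using hasDerivAt_const y (φ B t)

variable {φ} {σ}

theorem f_lt_excess_of_violated (hφ : ∀ B t, 0 ≤ φ B t)
    (h : ¬ I.SatisfiesConstraint σ φ S σ.length) : I.f σ σ.length S < I.excess := by
  unfold SatisfiesConstraint at h
  rw [not_le] at h
  have h1 : (0 : ℝ) ≤ ∑ v ∈ flushes Blk σ, (I.marg σ σ.length v S : ℝ) * φ v.1 v.2 :=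
    sum_nonneg fun v _ => mul_nonneg (by exact_mod_cast I.marg_nonneg σ _ v S) (hφ _ _)
  have h2 : (0 : ℤ) < I.excess - I.f σ σ.length S := by exact_mod_cast h1.trans_lt h
  omega

open Classical in
theorem cost_rate_le (hφ : ∀ B t, 0 ≤ φ B t) (hS : ∀ B, (B, 0) ∈ S)
    (h : ¬ I.SatisfiesConstraint σ φ S σ.length) :
    ∑ B : Blk, ∑ t ∈ Icc 1 σ.length, I.c B * (if I.Alive σ σ.length B t then
        I.rate σ S B t * (I.mass σ σ.length φ B t + 1 / (I.k * I.β)) else 0) ≤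
      3 * Real.log (I.k * I.β + 1) * (I.excess - I.f σ σ.length S) := by
  set ℓ := Real.log (I.k * I.β + 1) with hℓ
  have hlt := I.f_lt_excess_of_violated hφ h
  have hkβ := mul_pos I.k_pos I.blockSize_pos
  have h1 : ∑ B : Blk, ∑ t ∈ Icc 1 σ.length, I.c B * (if I.Alive σ σ.length B t then
        I.rate σ S B t * (I.mass σ σ.length φ B t + 1 / (I.k * I.β)) else 0) ≤
      ∑ v ∈ flushes Blk σ, (ℓ * (if I.Alive σ σ.length v.1 v.2 then
          (I.marg σ σ.length v S : ℝ) * I.mass σ σ.length φ v.1 v.2 else 0) +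
        ℓ * (1 / (I.k * I.β)) * ((if I.Alive σ σ.length v.1 v.2 then
          I.marg σ σ.length v S else 0 : ℤ) : ℝ)) := by
    rw [flushes, sum_product]
    refine sum_le_sum fun B _ => ?_
    have h2 : ∀ t, I.c B * (if I.Alive σ σ.length B t then
        I.rate σ S B t * (I.mass σ σ.length φ B t + 1 / (I.k * I.β)) else 0) =
        ℓ * (if I.Alive σ σ.length B t then
          (I.marg σ σ.length (B, t) S : ℝ) * I.mass σ σ.length φ B t else 0) +
        ℓ * (1 / (I.k * I.β)) * ((if I.Alive σ σ.length B t then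
          I.marg σ σ.length (B, t) S else 0 : ℤ) : ℝ) := by
      intro t
      have := (I.c_pos B).ne'
      split_ifs
      · rw [rate, ← hℓ]
        field_simp
      · simp
    simp only [← h2]
    refine sum_le_sum_of_subset_of_nonneg (fun t ht => ?_) fun t _ _ => ?_
    · rw [mem_Icc] at ht
      exact mem_range.2 (by omega)
    · refine mul_nonneg (I.c_pos B).le ?_
      split_ifs
      · exact mul_nonneg (I.rate_nonneg σ S B t)
          (add_nonneg (I.mass_nonneg σ _ hφ B t) I.one_div_mul_pos.le)
      · exact le_rfl
  refine h1.trans ?_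
  rw [sum_add_distrib, ← mul_sum, ← mul_sum, I.sum_marg_mul_mass σ φ hS]
  unfold SatisfiesConstraint at h
  rw [not_le] at h
  have h3 := I.sum_alive_marg_le σ hlt
  have h4 : ∑ v ∈ flushes Blk σ, ((if I.Alive σ σ.length v.1 v.2 then
          I.marg σ σ.length v S else 0 : ℤ) : ℝ) ≤
      2 * (I.k * I.β) * (I.excess - I.f σ σ.length S) := by exact_mod_cast h3
  push_cast at h
  have hℓ0 : 0 < ℓ := I.log_pos
  calc _ ≤ ℓ * (I.excess - I.f σ σ.length S) + ℓ * (1 / (I.k * I.β)) *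
        (2 * (I.k * I.β) * (I.excess - I.f σ σ.length S)) := by gcongr
    _ = _ := by
      have := I.k_pos.ne'; have := I.blockSize_pos.ne'
      field_simp
      ring

theorem fracCost_flow_le (hφ : ∀ B t, 0 ≤ φ B t) (hS : ∀ B, (B, 0) ∈ S) {d : ℝ} (hd : 0 ≤ d)
    (h : ∀ y ∈ Set.Ico 0 d, ¬ I.SatisfiesConstraint σ (I.flow σ φ S y) S σ.length) :
    I.fracCost σ (I.flow σ φ S d) ≤ I.fracCost σ φ +
      3 * Real.log (I.k * I.β + 1) * (I.excess - I.f σ σ.length S) * d := by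
  classical
  have hderiv : ∀ y, HasDerivAt (fun z => I.fracCost σ (I.flow σ φ S z))
      (∑ B : Blk, ∑ t ∈ Icc 1 σ.length, I.c B * (if I.Alive σ σ.length B t then
        I.rate σ S B t * (I.mass σ σ.length (I.flow σ φ S y) B t + 1 / (I.k * I.β)) else 0))
      y := fun y => HasDerivAt.fun_sum fun B _ => HasDerivAt.fun_sum fun t _ =>
        (I.hasDerivAt_flow σ φ y (hS B)).const_mul _
  have hlin : ∀ y, HasDerivAt (fun z => I.fracCost σ φ +
      3 * Real.log (I.k * I.β + 1) * (I.excess - I.f σ σ.length S) * z)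
      (3 * Real.log (I.k * I.β + 1) * (I.excess - I.f σ σ.length S)) y := fun y => by
    simpa using ((hasDerivAt_id y).const_mul
      (3 * Real.log (I.k * I.β + 1) * (I.excess - I.f σ σ.length S : ℝ))).const_add
        (I.fracCost σ φ)
  refine image_le_of_deriv_right_le_deriv_boundary
    (f := fun z => I.fracCost σ (I.flow σ φ S z))
    (B := fun z => I.fracCost σ φ +
      3 * Real.log (I.k * I.β + 1) * (I.excess - I.f σ σ.length S) * z)
    (fun y _ => (hderiv y).continuousAt.continuousWithinAt)
    (fun y _ => (hderiv y).hasDerivWithinAt) ?_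
    (fun y _ => (hlin y).continuousAt.continuousWithinAt)
    (fun y _ => (hlin y).hasDerivWithinAt)
    (fun y hy => I.cost_rate_le
      (fun B t => (hφ B t).trans (I.le_flow σ S hφ hy.1 B t)) hS (h y hy))
    (Set.right_mem_Icc.2 hd)
  simp [flow_zero]

theorem isIncrease_flow (hS : ∀ B, (B, 0) ∈ S) (hSf : S ⊆ flushes Blk σ) {d : ℝ} (hd : 0 < d)
    (h : ∀ y ∈ Set.Ico 0 d, ¬ I.SatisfiesConstraint σ (I.flow σ φ S y) S σ.length)
    (hsat : ∀ y ∈ Set.Ico 0 d, ∀ v ∈ flushes Blk σ,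
      1 ≤ I.mass σ σ.length (I.flow σ φ S y) v.1 v.2 → v ∈ S) :
    I.Increase σ φ (I.flow σ φ S d) := by
  refine ⟨S, hSf, d, hd, I.flow σ φ S, I.flow_zero σ φ S, rfl, h, hsat, fun y _ B t =>
    ⟨fun ha => ?_, fun ha => I.flow_of_not_alive σ φ S y ha⟩⟩
  have := I.hasDerivAt_flow σ φ y (t := t) (hS B)
  rw [if_pos ha] at this
  exact this.hasDerivWithinAt

/-- The first time at which the constraint of `S` holds or a flush outside `S` is saturated. -/
theorem exists_stopping_time (hφ : ∀ B t, 0 ≤ φ B t) (hS : ∀ B, (B, 0) ∈ S)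
    (hf : I.f σ σ.length (flushes Blk σ) = I.excess) (hSf : S ⊆ flushes Blk σ)
    (h : ¬ I.SatisfiesConstraint σ φ S σ.length)
    (hsat : ∀ v ∈ flushes Blk σ, 1 ≤ I.mass σ σ.length φ v.1 v.2 → v ∈ S) :
    ∃ d > 0,
      (∀ y ∈ Set.Ico 0 d, ¬ I.SatisfiesConstraint σ (I.flow σ φ S y) S σ.length) ∧
      (∀ y ∈ Set.Ico 0 d, ∀ v ∈ flushes Blk σ,
        1 ≤ I.mass σ σ.length (I.flow σ φ S y) v.1 v.2 → v ∈ S) ∧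
      (I.SatisfiesConstraint σ (I.flow σ φ S d) S σ.length ∨
        ∃ v ∈ flushes Blk σ, v ∉ S ∧ 1 ≤ I.mass σ σ.length (I.flow σ φ S d) v.1 v.2) := by
  set Z : Set ℝ := {y | 0 ≤ y} ∩
    ({y | I.SatisfiesConstraint σ (I.flow σ φ S y) S σ.length} ∪
      ⋃ v ∈ (flushes Blk σ \ S : Finset (Blk × ℕ)),
        {y | 1 ≤ I.mass σ σ.length (I.flow σ φ S y) v.1 v.2}) with hZ
  have hclosed : IsClosed Z := by
    refine isClosed_Ici.inter (IsClosed.union ?_ ?_)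
    · refine isClosed_le continuous_const (continuous_finsetSum _ fun v _ => ?_)
      exact continuous_const.mul (I.continuous_flow σ φ S v.1 v.2)
    · exact isClosed_biUnion_finset fun v _ =>
        isClosed_le continuous_const (I.continuous_mass_flow σ φ S v.1 v.2)
  have hne : Z.Nonempty := by
    have hlt := I.f_lt_excess_of_violated hφ h
    have h1 := I.f_union_sub_le_sum_marg σ σ.length S (flushes Blk σ)
    rw [union_eq_left.2 hSf, hf] at h1
    obtain ⟨⟨B, t⟩, hv, hpos⟩ : ∃ v ∈ flushes Blk σ, 0 < I.marg σ σ.length v S :=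
      exists_lt_of_sum_lt (by simp; omega)
    have hvS : (B, t) ∉ S := fun hm => hpos.ne' (I.marg_eq_zero_of_mem _ _ hm)
    have hr : 0 < I.rate σ S B t :=
      mul_pos (div_pos I.log_pos (I.c_pos B)) (by exact_mod_cast hpos)
    have hε := I.one_div_mul_pos
    -- At this time the exponent equals kβ, and exp(kβ) ≥ kβ + 1 lifts mass + ε from at least ε to
    -- at least 1 + ε.
    refine ⟨1 / ((1 / (I.k * I.β)) * I.rate σ S B t), (one_div_pos.2 (mul_pos hε hr)).le,
      Or.inr (Set.mem_biUnion (mem_sdiff.2 ⟨hv, hvS⟩) ?_)⟩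
    rw [Set.mem_ofPred_eq]
    have h2 := I.mass_flow σ φ (1 / ((1 / (I.k * I.β)) * I.rate σ S B t)) (hS B)
      (mem_flushes.1 hv)
    have h3 := Real.add_one_le_exp (I.rate σ S B t * (1 / ((1 / (I.k * I.β)) * I.rate σ S B t)))
    have h4 := I.mass_nonneg σ σ.length hφ B t
    have h5 : I.rate σ S B t * (1 / ((1 / (I.k * I.β)) * I.rate σ S B t)) = I.k * I.β := by
      have := I.k_pos.ne'; have := I.blockSize_pos.ne'; have := hr.ne'
      field_simp
    rw [h5] at h2 h3
    have h6 : (1 / (I.k * I.β) : ℝ) * (I.k * I.β + 1) ≤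
        (I.mass σ σ.length φ B t + 1 / (I.k * I.β)) * Real.exp (I.k * I.β) :=
      mul_le_mul (by linarith) h3 (by have := mul_pos I.k_pos I.blockSize_pos; linarith)
        (by linarith)
    have h7 : (1 / (I.k * I.β) : ℝ) * (I.k * I.β + 1) = 1 + 1 / (I.k * I.β) := by
      have := I.k_pos.ne'; have := I.blockSize_pos.ne'
      field_simp
    simp only
    linarith
  have hbdd : BddBelow Z := ⟨0, fun y hy => hy.1⟩
  have hmem := hclosed.csInf_mem hne hbdd
  have hbefore : ∀ y ∈ Set.Ico 0 (sInf Z), y ∉ Z := fun y hy hyZ =>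
    (csInf_le hbdd hyZ).not_gt hy.2
  have h0 : (0 : ℝ) ∉ Z := by
    rintro ⟨-, h0 | h0⟩
    · rw [Set.mem_ofPred_eq, flow_zero] at h0
      exact h h0
    · simp only [Set.mem_iUnion, Set.mem_ofPred_eq, flow_zero, mem_sdiff] at h0
      obtain ⟨v, ⟨hv, hvS⟩, hm⟩ := h0
      exact hvS (hsat v hv hm)
  refine ⟨sInf Z, lt_of_le_of_ne hmem.1 fun heq => h0 (heq ▸ hmem), fun y hy hs => ?_,
    fun y hy v hv hm => ?_, ?_⟩
  · exact hbefore y hy ⟨hy.1, Or.inl hs⟩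
  · by_contra hvS
    exact hbefore y hy ⟨hy.1, Or.inr (Set.mem_biUnion (mem_sdiff.2 ⟨hv, hvS⟩) hm)⟩
  · rcases hmem.2 with h1 | h1
    · exact Or.inl h1
    · simp only [Set.mem_iUnion, Set.mem_ofPred_eq, mem_sdiff] at h1
      obtain ⟨v, ⟨hv, hvS⟩, hm⟩ := h1
      exact Or.inr ⟨v, hv, hvS, hm⟩

end

section

variable {P Blk : Type*} [Fintype P] [DecidableEq P] [Fintype Blk] [DecidableEq Blk]
variable (I : BlockCaching P Blk)

/-! ### The dual certificate -/

/-- The part of the dual capacity `c_B` that is used up by a flush whose mass is `m`. -/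
noncomputable def loadBound (B : Blk) (m : ℝ) : ℝ :=
  I.c B / Real.log (I.k * I.β + 1) *
    (Real.log (min 1 m + 1 / (I.k * I.β)) - Real.log (1 / (I.k * I.β)))

theorem loadBound_mono (B : Blk) {m m' : ℝ} (hm : 0 ≤ m) (h : m ≤ m') :
    I.loadBound B m ≤ I.loadBound B m' := by
  have hε := I.one_div_mul_pos
  refine mul_le_mul_of_nonneg_left (sub_le_sub_right (Real.log_le_log ?_ ?_) _)
    (div_nonneg (I.c_pos B).le I.log_pos.le)
  · have := le_min zero_le_one hm
    linarith
  · have := min_le_min_left 1 h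
    linarith

theorem loadBound_nonneg (B : Blk) {m : ℝ} (hm : 0 ≤ m) : 0 ≤ I.loadBound B m := by
  have := I.loadBound_mono B le_rfl hm
  simpa [loadBound] using this

theorem loadBound_le (B : Blk) {m : ℝ} (hm : 0 ≤ m) : I.loadBound B m ≤ I.c B := by
  have h1 := I.loadBound_mono B hm (le_max_right 1 m)
  refine h1.trans_eq ?_
  have hk := I.k_pos
  have hβ := I.blockSize_pos
  rw [loadBound, min_eq_left (le_max_left 1 m), ← Real.log_div
    (by have := I.one_div_mul_pos; positivity) I.one_div_mul_pos.ne']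
  have : ((1 : ℝ) + 1 / (I.k * I.β)) / (1 / (I.k * I.β)) = I.k * I.β + 1 := by
    field_simp
  rw [this, div_mul_cancel₀ _ I.log_pos.ne']

/-- A solution that the primal-dual scheme may hold: its cost is paid for by a dual solution, which
is represented by its value `D` and by the loads `L` of the dual constraints. -/
structure Certified (σ : List P) (φ : Blk → ℕ → ℝ) : Prop where
  nonneg : ∀ B t, 0 ≤ φ B t
  one_le_zero : ∀ B, 1 ≤ φ B 0
  eq_zero_of_lt : ∀ B t, σ.length < t → φ B t = 0
  exists_dual : ∃ (D : ℝ) (L : Blk → ℕ → ℝ),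
    I.fracCost σ φ ≤ 3 * Real.log (I.k * I.β + 1) * D ∧
    (∀ ψ, I.Feasible σ ψ → D ≤ ∑ v ∈ flushes Blk σ, L v.1 v.2 * ψ v.1 v.2) ∧
    (∀ B, L B 0 = 0) ∧ (∀ B t, σ.length < t → L B t = 0) ∧
    ∀ B, ∀ t ≤ σ.length, L B t ≤ I.loadBound B (I.mass σ σ.length φ B t)

theorem certified_initial : I.Certified ([] : List P) (initial Blk) := by
  have h : ∀ B t, 0 ≤ initial Blk B t := fun B t => by unfold initial; split_ifs <;> simp
  refine ⟨h, fun B => by simp [initial], fun B t ht => by simp at ht; simp [initial]; omega,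
    0, fun _ _ => 0, by simp [fracCost], by simp, by simp, by simp, fun B t _ => ?_⟩
  exact I.loadBound_nonneg B (I.mass_nonneg _ _ h B t)

variable {I}

theorem mass_append_ge {σ : List P} {φ : Blk → ℕ → ℝ} (hφ : ∀ B t, 0 ≤ φ B t) (p : P)
    (B : Blk) {t : ℕ} (ht : t ≤ σ.length) :
    I.mass σ σ.length φ B t ≤ I.mass (σ ++ [p]) (σ.length + 1) φ B t := by
  classical
  rw [mass_eq, mass_eq]
  refine sum_le_sum_of_subset_of_nonneg (fun u hu => ?_) fun _ _ _ => hφ _ _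
  simp only [mem_filter, mem_range] at hu ⊢
  exact ⟨by omega, hu.2.append p (by omega) ht⟩

theorem fracCost_append {σ : List P} {φ : Blk → ℕ → ℝ} (p : P)
    (h : ∀ B, φ B (σ.length + 1) = 0) : I.fracCost (σ ++ [p]) φ = I.fracCost σ φ := by
  unfold fracCost
  refine sum_congr rfl fun B _ => ?_
  rw [List.length_append, List.length_singleton, sum_Icc_succ_top (by omega), h]
  simp

theorem Certified.append {σ : List P} {φ : Blk → ℕ → ℝ} (h : I.Certified σ φ) (p : P) :
    I.Certified (σ ++ [p]) φ := by
  obtain ⟨D, L, h1, h2, h3, h4, h5⟩ := h.exists_dual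
  refine ⟨h.nonneg, h.one_le_zero, fun B t ht => h.eq_zero_of_lt B t (by simp at ht; omega),
    D, L, ?_, fun ψ hψ => ?_, h3, fun B t ht => h4 B t (by simp at ht; omega), fun B t ht => ?_⟩
  · rwa [fracCost_append p fun B => h.eq_zero_of_lt B _ (by omega)]
  · rw [sum_flushes_append σ p (fun v => L v.1 v.2 * ψ v.1 v.2)
      fun B => by simp [h4 B (σ.length + 1) (by omega)]]
    exact h2 ψ hψ.of_append
  · rw [List.length_append, List.length_singleton] at ht ⊢
    rcases ht.lt_or_eq with hlt | rfl
    · have hle : t ≤ σ.length := by omega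
      exact (h5 B t hle).trans
        (I.loadBound_mono B (I.mass_nonneg _ _ h.nonneg B t) (mass_append_ge h.nonneg p B hle))
    · rw [h4 B _ (by omega)]
      exact I.loadBound_nonneg B (I.mass_nonneg _ _ h.nonneg B _)

/-- Along the flow ln(mass + ε) is linear with slope `rate`, so equality holds as long as the cap at
1 is inactive. A positive marginal value means the flush is outside `S`, hence unsaturated before
the end; continuity covers the endpoint. -/
theorem load_flow_le {σ : List P} {φ : Blk → ℕ → ℝ} {S : Finset (Blk × ℕ)} {d : ℝ} (hd : 0 < d)
    (hφ : ∀ B t, 0 ≤ φ B t) (hS : ∀ B, (B, 0) ∈ S)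
    (hsat : ∀ y ∈ Set.Ico 0 d, ∀ v ∈ flushes Blk σ,
      1 ≤ I.mass σ σ.length (I.flow σ φ S y) v.1 v.2 → v ∈ S)
    (B : Blk) {t : ℕ} (ht : t ≤ σ.length) :
    I.loadBound B (I.mass σ σ.length φ B t) + d * I.marg σ σ.length (B, t) S ≤
      I.loadBound B (I.mass σ σ.length (I.flow σ φ S d) B t) := by
  by_cases h0 : I.marg σ σ.length (B, t) S = 0
  · rw [h0]
    simpa using I.loadBound_mono B (I.mass_nonneg _ _ hφ B t)
      (I.mass_mono σ σ.length (I.le_flow σ S hφ hd.le) B t)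
  · have hlt : ∀ y ∈ Set.Ico 0 d, I.mass σ σ.length (I.flow σ φ S y) B t ≤ 1 := by
      intro y hy
      by_contra hm
      exact h0 (I.marg_eq_zero_of_mem _ _
        (hsat y hy (B, t) (mem_flushes.2 ht) (not_le.1 hm).le))
    have hle : I.mass σ σ.length (I.flow σ φ S d) B t ≤ 1 := by
      have hc : IsClosed {y | I.mass σ σ.length (I.flow σ φ S y) B t ≤ 1} :=
        isClosed_le (I.continuous_mass_flow σ φ S B t) continuous_const
      have := hc.closure_subset_iff.2 hlt
      rw [closure_Ico hd.ne] at this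
      exact this (Set.right_mem_Icc.2 hd.le)
    have hle0 := hlt 0 (Set.left_mem_Ico.2 hd)
    rw [flow_zero] at hle0
    have hpos : 0 < I.mass σ σ.length φ B t + 1 / (I.k * I.β) :=
      add_pos_of_nonneg_of_pos (I.mass_nonneg _ _ hφ B t) I.one_div_mul_pos
    rw [loadBound, loadBound, min_eq_right hle, min_eq_right hle0,
      I.mass_flow σ φ d (hS B) ht, Real.log_mul hpos.ne' (Real.exp_ne_zero _), Real.log_exp, rate]
    refine le_of_eq ?_
    have := (I.c_pos B).ne'
    have := I.log_pos.ne'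
    field_simp
    ring

theorem Certified.flow {σ : List P} {φ : Blk → ℕ → ℝ} (h : I.Certified σ φ)
    {S : Finset (Blk × ℕ)} {d : ℝ} (hd : 0 < d) (hσ : 1 ≤ σ.length)
    (hS : ∀ B, (B, 0) ∈ S) (hSf : S ⊆ flushes Blk σ)
    (hviol : ∀ y ∈ Set.Ico 0 d, ¬ I.SatisfiesConstraint σ (I.flow σ φ S y) S σ.length)
    (hsat : ∀ y ∈ Set.Ico 0 d, ∀ v ∈ flushes Blk σ,
      1 ≤ I.mass σ σ.length (I.flow σ φ S y) v.1 v.2 → v ∈ S) :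
    I.Certified σ (I.flow σ φ S d) := by
  have hle := I.le_flow σ S h.nonneg hd.le
  obtain ⟨D, L, h1, h2, h3, h4, h5⟩ := h.exists_dual
  refine ⟨fun B t => (h.nonneg B t).trans (hle B t), fun B => (h.one_le_zero B).trans (hle B 0),
    fun B t ht => (I.flow_of_lt σ φ S d ht).trans (h.eq_zero_of_lt B t ht),
    -- The old dual inequality plus `d` times the constraint of `S`.
    D + d * (I.excess - I.f σ σ.length S),
    fun B t => L B t + d * I.marg σ σ.length (B, t) S, ?_, fun ψ hψ => ?_, fun B => ?_,
    fun B t ht => ?_, fun B t ht => ?_⟩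
  · have := I.fracCost_flow_le h.nonneg hS hd.le hviol
    linarith
  · have h6 := h2 ψ hψ
    have h7 := hψ.2 σ.length (mem_Icc.2 ⟨hσ, le_rfl⟩) S hSf
    unfold SatisfiesConstraint at h7
    push_cast at h7
    simp only [add_mul, sum_add_distrib, mul_assoc]
    rw [← mul_sum]
    exact add_le_add h6 (mul_le_mul_of_nonneg_left h7 hd.le)
  · simp [h3 B, I.marg_eq_zero_of_mem σ σ.length (hS B)]
  · simp [h4 B t ht, I.marg_eq_zero_of_lt σ S ht]
  · have := load_flow_le hd h.nonneg hS hsat B ht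
    have := h5 B t ht
    linarith

/-! ### Serving one request -/

variable (I) in
open Classical in
/-- The number of violated constraints at the last time plus the number of unsaturated flushes. -/
noncomputable def deficiency (σ : List P) (φ : Blk → ℕ → ℝ) : ℕ :=
  #{S ∈ (flushes Blk σ).powerset | ¬ I.SatisfiesConstraint σ φ S σ.length} +
    #{v ∈ flushes Blk σ | ¬ 1 ≤ I.mass σ σ.length φ v.1 v.2}

theorem Certified.exists_increase {σ : List P} {φ : Blk → ℕ → ℝ} (h : I.Certified σ φ)
    (hσ : 1 ≤ σ.length) (hf : I.f σ σ.length (flushes Blk σ) = I.excess)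
    {S₀ : Finset (Blk × ℕ)} (hS₀ : S₀ ⊆ flushes Blk σ)
    (hviol₀ : ¬ I.SatisfiesConstraint σ φ S₀ σ.length) :
    ∃ φ', I.Increase σ φ φ' ∧ I.Certified σ φ' ∧ (∀ B t, φ B t ≤ φ' B t) ∧
      (∀ B t, φ B t ≠ φ' B t → I.Alive σ σ.length B t) ∧
      I.deficiency σ φ' < I.deficiency σ φ := by
  classical
  -- Enlarging `S₀` by all saturated flushes meets the scheme's side condition and puts every `(B,
  -- 0)` into `S`.
  set S := {v ∈ flushes Blk σ | 1 ≤ I.mass σ σ.length φ v.1 v.2} ∪ S₀ with hSdef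
  have hSf : S ⊆ flushes Blk σ := union_subset (filter_subset _ _) hS₀
  have hsat₀ : ∀ v ∈ flushes Blk σ, 1 ≤ I.mass σ σ.length φ v.1 v.2 → v ∈ S := fun v hv hm =>
    mem_union_left _ (mem_filter.2 ⟨hv, hm⟩)
  have hS : ∀ B, (B, 0) ∈ S := fun B => hsat₀ _ (mem_flushes.2 (Nat.zero_le _))
    ((h.one_le_zero B).trans (I.le_mass σ h.nonneg B (Nat.zero_le _)))
  have hviol : ¬ I.SatisfiesConstraint σ φ S σ.length := fun hs =>
    hviol₀ (hs.of_union h.nonneg fun w hw => by simpa using hw)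
  obtain ⟨d, hd, h1, h2, h3⟩ := I.exists_stopping_time h.nonneg hS hf hSf hviol hsat₀
  have hle := I.le_flow σ S h.nonneg hd.le
  refine ⟨I.flow σ φ S d, I.isIncrease_flow hS hSf hd h1 h2, h.flow hd hσ hS hSf h1 h2, hle,
    fun B t hne => ?_, ?_⟩
  · by_contra ha
    exact hne (I.flow_of_not_alive σ φ S d ha).symm
  · have hsub1 : ({R ∈ (flushes Blk σ).powerset |
        ¬ I.SatisfiesConstraint σ (I.flow σ φ S d) R σ.length} : Finset _) ⊆
        {R ∈ (flushes Blk σ).powerset | ¬ I.SatisfiesConstraint σ φ R σ.length} :=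
      monotone_filter_right _ fun R _ hR hs => hR (hs.mono hle)
    have hsub2 : ({v ∈ flushes Blk σ |
        ¬ 1 ≤ I.mass σ σ.length (I.flow σ φ S d) v.1 v.2} : Finset _) ⊆
        {v ∈ flushes Blk σ | ¬ 1 ≤ I.mass σ σ.length φ v.1 v.2} :=
      monotone_filter_right _ fun v _ hv hm => hv (hm.trans (I.mass_mono σ _ hle _ _))
    rcases h3 with h3 | ⟨v, hv, hvS, hm⟩
    · refine add_lt_add_of_lt_of_le (card_lt_card ⟨hsub1, fun hs => ?_⟩) (card_le_card hsub2)
      exact (mem_filter.1 (hs (mem_filter.2 ⟨mem_powerset.2 hSf, hviol⟩))).2 h3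
    · refine add_lt_add_of_le_of_lt (card_le_card hsub1) (card_lt_card ⟨hsub2, fun hs => ?_⟩)
      exact (mem_filter.1 (hs (mem_filter.2 ⟨hv, fun hm₀ => hvS (hsat₀ v hv hm₀)⟩))).2 hm

theorem Certified.exists_serve {σ : List P} {φ : Blk → ℕ → ℝ} (h : I.Certified σ φ)
    (hσ : 1 ≤ σ.length) (hf : I.f σ σ.length (flushes Blk σ) = I.excess) :
    ∃ φ', Relation.ReflTransGen (I.Increase σ) φ φ' ∧ I.Certified σ φ' ∧
      (∀ B t, φ B t ≤ φ' B t) ∧ (∀ B t, φ B t ≠ φ' B t → I.Alive σ σ.length B t) ∧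
      ∀ S ⊆ flushes Blk σ, I.SatisfiesConstraint σ φ' S σ.length := by
  induction hn : I.deficiency σ φ using Nat.strong_induction_on generalizing φ with
  | _ n ih =>
    by_cases hS : ∀ S ⊆ flushes Blk σ, I.SatisfiesConstraint σ φ S σ.length
    · exact ⟨φ, .refl, h, fun _ _ => le_rfl, fun _ _ hne => absurd rfl hne, hS⟩
    · push Not at hS
      obtain ⟨S, hSf, hviol⟩ := hS
      obtain ⟨φ₁, hinc, hc, hle, hal, hlt⟩ := h.exists_increase hσ hf hSf hviol
      obtain ⟨φ', hr, hc', hle', hal', hsat⟩ := ih _ (hn ▸ hlt) hc rfl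
      refine ⟨φ', .head hinc hr, hc', fun B t => (hle B t).trans (hle' B t),
        fun B t hne => ?_, hsat⟩
      by_cases heq : φ B t = φ₁ B t
      · exact hal' B t (heq ▸ hne)
      · exact hal B t heq

theorem Certified.exists_next {σ : List P} {φ : Blk → ℕ → ℝ} (h : I.Certified σ φ) (p : P) :
    ∃ φ', Relation.ReflTransGen (I.Increase (σ ++ [p])) φ φ' ∧ I.Certified (σ ++ [p]) φ' ∧
      (∀ B t, φ B t ≤ φ' B t) ∧
      (∀ B t, φ B t ≠ φ' B t → I.Alive (σ ++ [p]) (σ.length + 1) B t) ∧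
      ∀ S ⊆ flushes Blk (σ ++ [p]),
        I.SatisfiesConstraint (σ ++ [p]) φ' S (σ.length + 1) := by
  have hl : (σ ++ [p]).length = σ.length + 1 := by simp
  have := (h.append p).exists_serve (by omega) (by rw [hl]; exact I.f_flushes σ p)
  rwa [hl] at this

/-! ### The algorithm -/

variable (I)

open Classical in
/-- The solution held after one more request. -/
noncomputable def next (σ : List P) (p : P) (φ : Blk → ℕ → ℝ) : Blk → ℕ → ℝ :=
  -- The fallback is never used along the algorithm, by `certified_algorithm`.
  if h : I.Certified σ φ then (h.exists_next p).choose else φ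

/-- The online algorithm. -/
noncomputable def algorithm (σ : List P) : Blk → ℕ → ℝ :=
  σ.reverseRecOn (initial Blk) fun σ p φ => I.next σ p φ

theorem algorithm_nil : I.algorithm [] = initial Blk := by
  simp [algorithm]

theorem algorithm_concat (σ : List P) (p : P) :
    I.algorithm (σ ++ [p]) = I.next σ p (I.algorithm σ) := by
  simp [algorithm]

variable {I}

theorem Certified.next_spec {σ : List P} {φ : Blk → ℕ → ℝ} (h : I.Certified σ φ) (p : P) :
    Relation.ReflTransGen (I.Increase (σ ++ [p])) φ (I.next σ p φ) ∧
      I.Certified (σ ++ [p]) (I.next σ p φ) ∧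
      (∀ B t, φ B t ≤ I.next σ p φ B t) ∧
      (∀ B t, φ B t ≠ I.next σ p φ B t → I.Alive (σ ++ [p]) (σ.length + 1) B t) ∧
      ∀ S ⊆ flushes Blk (σ ++ [p]),
        I.SatisfiesConstraint (σ ++ [p]) (I.next σ p φ) S (σ.length + 1) := by
  rw [next, dif_pos h]
  exact (h.exists_next p).choose_spec

variable (I)

theorem certified_algorithm (σ : List P) : I.Certified σ (I.algorithm σ) := by
  induction σ using List.reverseRecOn with
  | nil => rw [algorithm_nil]; exact I.certified_initial
  | append_singleton σ p ih => rw [algorithm_concat]; exact (ih.next_spec p).2.1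

theorem feasible_algorithm (σ : List P) : I.Feasible σ (I.algorithm σ) := by
  induction σ using List.reverseRecOn with
  | nil =>
    refine ⟨fun B t _ => (I.certified_algorithm []).nonneg B t, fun τ hτ => ?_⟩
    simp only [mem_Icc, List.length_nil] at hτ
    omega
  | append_singleton σ p ih =>
    obtain ⟨-, h1, h2, -, h3⟩ := (I.certified_algorithm σ).next_spec p
    rw [algorithm_concat]
    exact ih.append h2 h1.nonneg h3

theorem Feasible.fracCost_nonneg {I : BlockCaching P Blk} {σ : List P} {ψ : Blk → ℕ → ℝ}
    (h : I.Feasible σ ψ) : 0 ≤ I.fracCost σ ψ :=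
  sum_nonneg fun B _ => sum_nonneg fun t ht =>
    mul_nonneg (I.c_pos B).le (h.1 B t (mem_Icc.1 ht).2)

/-- Weak duality. Flushes at time `0` are free in the objective, which is why the certificate gives
them no load. -/
theorem Certified.fracCost_le {I : BlockCaching P Blk} {σ : List P} {φ ψ : Blk → ℕ → ℝ}
    (h : I.Certified σ φ) (hψ : I.Feasible σ ψ) :
    I.fracCost σ φ ≤ 3 * Real.log (I.k * I.β + 1) * I.fracCost σ ψ := by
  obtain ⟨D, L, h1, h2, h3, h4, h5⟩ := h.exists_dual
  refine h1.trans (mul_le_mul_of_nonneg_left ((h2 ψ hψ).trans ?_)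
    (mul_nonneg (by norm_num) I.log_pos.le))
  rw [flushes, sum_product, fracCost]
  refine sum_le_sum fun B _ => ?_
  have hsplit : range (σ.length + 1) = insert 0 (Icc 1 σ.length) := by
    ext t
    simp only [mem_range, mem_insert, mem_Icc]
    omega
  rw [hsplit, sum_insert (by simp)]
  simp only [h3, zero_mul, zero_add]
  refine sum_le_sum fun t ht => ?_
  have ht' := (mem_Icc.1 ht).2
  exact mul_le_mul_of_nonneg_right ((h5 B t ht').trans
    (I.loadBound_le B (I.mass_nonneg σ _ h.nonneg B t))) (hψ.1 B t ht')

theorem log_mul_le : Real.log (I.k * I.β + 1) ≤ 2 * Real.log (I.k + 1) := by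
  have hk := I.k_pos
  have hβ : (I.β : ℝ) ≤ I.k := by exact_mod_cast I.β_le_k
  have : 2 * Real.log (I.k + 1) = Real.log ((I.k + 1 : ℝ) ^ 2) := by
    rw [Real.log_pow]; norm_num
  rw [this]
  refine Real.log_le_log (by have := mul_pos hk I.blockSize_pos; linarith) ?_
  nlinarith

theorem Feasible.fracCost_algorithm_le {I : BlockCaching P Blk} {σ : List P} {ψ : Blk → ℕ → ℝ}
    (hψ : I.Feasible σ ψ) :
    I.fracCost σ (I.algorithm σ) ≤ 6 * Real.log (I.k + 1) * I.fracCost σ ψ := by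
  refine ((I.certified_algorithm σ).fracCost_le hψ).trans
    (mul_le_mul_of_nonneg_right ?_ hψ.fracCost_nonneg)
  have := I.log_mul_le
  linarith

/-! ### Cache policies are fractional solutions -/

open Classical in
/-- The flushes made by a cache policy, and all flushes at time `0`. -/
noncomputable def policyFlushes (C : ℕ → Finset P) (B : Blk) (t : ℕ) : ℝ :=
  if t = 0 ∨ ∃ p ∈ C (t - 1) \ C t, I.blk p = B then 1 else 0

theorem fracCost_policyFlushes (σ : List P) (C : ℕ → Finset P) :
    I.fracCost σ (I.policyFlushes C) = I.evictionCost σ C := by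
  rw [fracCost, evictionCost, sum_comm]
  refine sum_congr rfl fun t ht => sum_congr rfl fun B _ => ?_
  have : t ≠ 0 := by have := (mem_Icc.1 ht).1; omega
  simp only [policyFlushes, this, false_or, mul_ite, mul_one, mul_zero]
  congr

theorem exists_eviction {C : ℕ → Finset P} {p : P} {r τ : ℕ} (hrτ : r ≤ τ) (hr : p ∈ C r)
    (hτ : p ∉ C τ) : ∃ t, r < t ∧ t ≤ τ ∧ p ∈ C (t - 1) \ C t := by
  induction τ, hrτ using Nat.le_induction with
  | base => exact absurd hr hτ
  | succ τ hle ih =>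
    by_cases h : p ∈ C τ
    · exact ⟨τ + 1, by omega, le_rfl, mem_sdiff.2 ⟨h, hτ⟩⟩
    · obtain ⟨t, h1, h2, h3⟩ := ih h
      exact ⟨t, h1, h2.trans (Nat.le_succ τ), h3⟩

/-- A page outside the cache is missing: either it was evicted after its last request, or it was
never requested and the flush at time `0` counts, whatever the initial content. At least n - k pages
are outside, so the policy's flushes attain the maximum of `f`, and submodularity gives every
constraint. -/
theorem IsPolicy.feasible {I : BlockCaching P Blk} {σ : List P} {C : ℕ → Finset P}
    (hC : I.IsPolicy σ C) : I.Feasible σ (I.policyFlushes C) := by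
  classical
  refine ⟨fun B t _ => by unfold policyFlushes; split_ifs <;> simp, fun τ hτ S _ => ?_⟩
  rw [mem_Icc] at hτ
  set U := {v ∈ flushes Blk σ | v.2 = 0 ∨ ∃ p ∈ C (v.2 - 1) \ C v.2, I.blk p = v.1} with hU
  have hmiss : (C τ)ᶜ ⊆ I.missingSet σ τ U := by
    intro p hp
    rw [mem_compl] at hp
    rw [mem_missingSet]
    rcases WithBot.eq_bot_or_eq_natCast (lastReq σ p τ) with hr | ⟨r, hr⟩
    · refine ⟨0, hr ▸ WithBot.bot_lt_coe 0, Nat.zero_le _, ?_⟩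
      simp [hU, mem_flushes]
    · have h1 := lastReq_eq_coe hr
      have h2 := mem_Icc.1 h1.1
      have h3 := hC.2 r (mem_Icc.2 ⟨h2.1, h2.2.trans hτ.2⟩) p h1.2
      obtain ⟨t, ht1, ht2, ht3⟩ := exists_eviction h2.2 h3 hp
      refine ⟨t, hr ▸ Nat.cast_lt.2 ht1, ht2, ?_⟩
      exact mem_filter.2 ⟨mem_flushes.2 (ht2.trans hτ.2), Or.inr ⟨p, ht3, rfl⟩⟩
  have hf : I.f σ τ (U ∪ S) = I.excess := by
    have h1 := card_le_card (hmiss.trans (I.missingSet_mono σ τ (subset_union_left (s₂ := S))))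
    have h2 := card_compl (C τ)
    have h3 := hC.1 τ hτ.2
    have h4 := card_le_univ (C τ)
    rw [f_eq, excess]
    omega
  have hsum := I.f_union_sub_le_sum_marg σ τ S U
  rw [hf] at hsum
  unfold SatisfiesConstraint
  have heq : ∑ v ∈ flushes Blk σ, (I.marg σ τ v S : ℝ) * I.policyFlushes C v.1 v.2 =
      ((∑ v ∈ U, I.marg σ τ v S : ℤ) : ℝ) := by
    rw [hU, sum_filter]
    push_cast
    refine sum_congr rfl fun v _ => ?_
    simp only [policyFlushes, mul_ite, mul_one, mul_zero]
  rw [heq]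
  exact_mod_cast hsum

end

end BlockCaching

theorem mainTheorem2 :
    ∃ K : ℝ, 0 < K ∧
      ∀ (P : Type*) (Blk : Type*) [Fintype P] [DecidableEq P] [Fintype Blk] [DecidableEq Blk]
        (I : BlockCaching P Blk),
        ∃ A : List P → Blk → ℕ → ℝ,
          I.IsFractionalAlgorithm A ∧
          BlockCaching.IsMonotoneIncremental A ∧
          I.RaisesOnlyAlive A ∧
          I.IsPrimalDualScheme A ∧
          I.IsCompetitive A (K * Real.log (I.k + 1)) := by
  refine ⟨6, by norm_num, fun P Blk _ _ _ _ I => ⟨I.algorithm, fun σ => ?_, fun σ p => ?_,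
    fun σ p => ?_, ⟨I.algorithm_nil, fun σ p => ?_⟩, fun σ => ⟨fun C hC => ?_, fun ψ hψ => ?_⟩⟩⟩
  · exact ⟨I.feasible_algorithm σ, (I.certified_algorithm σ).eq_zero_of_lt⟩
  · rw [I.algorithm_concat]
    exact ((I.certified_algorithm σ).next_spec p).2.2.1
  · rw [I.algorithm_concat]
    exact ((I.certified_algorithm σ).next_spec p).2.2.2.1
  · rw [I.algorithm_concat]
    exact ((I.certified_algorithm σ).next_spec p).1
  · rw [← I.fracCost_policyFlushes]
    exact hC.feasible.fracCost_algorithm_le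
  · exact hψ.fracCost_algorithm_le
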